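/- Let $k>0$, $h>0$, $H\in\mathbb R$, and let $\Phi(x,y)=\frac{i}{4}H_0^{(1)}(k|x-y|)$ be the fundamental solution of the Helmholtz equation in $\mathbb R^2$, where $H_0^{(1)}=J_0+iY_0$ is the Hankel function of the first kind of order $0$. Let $\Gamma^H=\mathbb R\times\{H\}$. For $x=(x_1,x_2)$ put $\tilde x=x-(0,H)$, $r=|\tilde x|=\sqrt{x_1^2+(x_2-H)^2}$ and $\frac{\partial}{\partial r}=\frac{\tilde x}{|\tilde x|}\cdot\nabla_x$. For $y=(y_1,H)\in\Gamma^H$ define the kernels $$S(x,y)=\frac{\partial\Phi(x,y)}{\partial y_2},\qquad K(x,y)=\frac{\partial^2\Phi(x,y)}{\partial r\,\partial y_2}-ik\,S(x,y).$$ (a) There is a constant $C>0$, depending only on $k$, $H$ and $h$, such that for all $x$ with $x_2\ge H+h$ and all $y=(y_1,H)\in\Gamma^H$, $$|S(x,y)|\le C|x-y|^{-1/2},\qquad |K(x,y)|\le C|x-y|^{-1/2},$$ and, if moreover $|y_1|<\sqrt r$, then $|K(x,y)|\le C|x-y|^{-3/2}$. (b) Let $\phi:\Gamma^H\to\mathbb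 C$ be a (measurable) function that decays super-algebraically, i.e. for every $m\in\mathbb N$ there is a constant $C_m$ such that $|\phi(y)|\le C_m(1+|y|^2)^{-m}$ for all $y\in\Gamma^H$, and let $$u(x)=\int_{\Gamma^H}\frac{\partial\Phi(x,y)}{\partial y_2}\,\phi(y)\,ds(y),\qquad x_2\ge H+h.$$ Then for every $x$ with $x_2\ge H+h$ this integral converges absolutely, $u$ (given by the same integral for all $x_2>H$) is differentiable at $x$, and $$\frac{\partial u}{\partial r}(x)-ik\,u(x)=\int_{\Gamma^H}K(x,y)\,\phi(y)\,ds(y),$$ where the integral on the right also converges absolutely. Moreover, there is a constant $C>0$ that does not depend on $x$ such that $$|u(x)|\le C\,r^{-1/2},\qquad \left|\frac{\partial u}{\partial r}(x)-ik\,u(x)\right|\le C\,r^{-3/2}$$ for all $x$ with $x_2\ge H+h$. -/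

import Mathlib

noncomputable section

/-- The Bessel function of the first kind of order zero,
`J₀(t) = ∑ₘ (-1)ᵐ (t²/4)ᵐ / (m!)²`. -/
def besselJZero (t : ℝ) : ℝ :=
  ∑' m : ℕ, (-1) ^ m * (t ^ 2 / 4) ^ m / ((m.factorial : ℝ)) ^ 2

/-- The Bessel function of the second kind (Neumann function) of order zero, for `t > 0`,
`Y₀(t) = (2/π) (log (t/2) + γ) J₀(t) - (2/π) ∑ₘ (-1)ᵐ hₘ (t²/4)ᵐ / (m!)²`,
where `γ` is Euler's constant and `hₘ = 1 + 1/2 + ⋯ + 1/m`. -/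
def besselYZero (t : ℝ) : ℝ :=
  2 / Real.pi * (Real.log (t / 2) + Real.eulerMascheroniConstant) * besselJZero t
    - 2 / Real.pi *
      ∑' m : ℕ, (-1) ^ m * ((harmonic m : ℚ) : ℝ) * (t ^ 2 / 4) ^ m / ((m.factorial : ℝ)) ^ 2

/-- The Hankel function of the first kind of order zero, `H₀⁽¹⁾(t) = J₀(t) + i Y₀(t)`, `t > 0`. -/
def hankelZero (t : ℝ) : ℂ := (besselJZero t : ℂ) + Complex.I * (besselYZero t : ℂ)

/-- The plane with its Euclidean norm; `x 0` and `x 1` are the coordinates `x₁` and `x₂`. -/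
abbrev Plane : Type := EuclideanSpace ℝ (Fin 2)

/-- The fundamental solution `Φ(x,y) = (i/4) H₀⁽¹⁾(k|x-y|)` of the Helmholtz equation. -/
def fundSol (k : ℝ) (x y : Plane) : ℂ := Complex.I / 4 * hankelZero (k * ‖x - y‖)

/-- The kernel `S(x,y) = ∂Φ(x,y)/∂y₂`. -/
def layerKernel (k : ℝ) (x y : Plane) : ℂ :=
  deriv (fun s : ℝ => fundSol k x !₂[y 0, s]) (y 1)

/-- The centre `(0,H)` of the polar coordinates. -/
def centre (H : ℝ) : Plane := !₂[0, H]

/-- The polar radius `r = |x - (0,H)|`. -/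
def radius (H : ℝ) (x : Plane) : ℝ := ‖x - centre H‖

/-- The radial derivative `∂f/∂r = (x - (0,H))/|x - (0,H)| · ∇f(x)`. -/
def radialDeriv (H : ℝ) (f : Plane → ℂ) (x : Plane) : ℂ :=
  fderiv ℝ f x ((radius H x)⁻¹ • (x - centre H))

/-- The kernel `K(x,y) = ∂²Φ(x,y)/∂r∂y₂ - i k S(x,y)`. -/
def radiationKernel (k H : ℝ) (x y : Plane) : ℂ :=
  radialDeriv H (fun z => layerKernel k z y) x - Complex.I * k * layerKernel k x y

/-- The point `(t,H)` of the line `Γ^H = ℝ × {H}`; `t` is the arc length along `Γ^H`, and functions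
on `Γ^H` are written as functions of `t`. -/
def linePt (H t : ℝ) : Plane := !₂[t, H]

/-- The potential `u(x) = ∫_{Γ^H} ∂Φ(x,y)/∂y₂ φ(y) ds(y)`. -/
def layerPotential (k H : ℝ) (φ : ℝ → ℂ) (x : Plane) : ℂ :=
  ∫ t : ℝ, layerKernel k x (linePt H t) * φ t

/-- Super-algebraic decay on `Γ^H`: for every `m` there is `C` with
`|φ(y)| ≤ C (1 + |y|²)^(-m)` for all `y ∈ Γ^H`. -/
def SuperAlgebraicDecay (H : ℝ) (φ : ℝ → ℂ) : Prop :=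
  ∀ m : ℕ, ∃ C : ℝ, ∀ t : ℝ, ‖φ t‖ ≤ C / (1 + ‖linePt H t‖ ^ 2) ^ m

end

/-!
The analytic heart is the behaviour of `H₀⁽¹⁾` at infinity, namely `H₀⁽¹⁾' = O(t^(-1/2))` and the
radiation condition `H₀⁽¹⁾'' - i H₀⁽¹⁾' = O(t^(-3/2))`. Both are read off the Laplace integral
`H₀⁽¹⁾(t) = -(2i/π) ∫₀^∞ e^{t (i - s)} / √(s (s - 2i)) ds` (`hankelZero_eq`), since each derivative
in `t` produces a factor `i - s`, and a factor `s` gains a power of `t`.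

As the Bessel functions are given by their power series at the origin, the representation is a
connection formula. Both sides solve Bessel's equation: for the series this is an identity between
coefficients, for the integral the integrand is an exact derivative (`hankelIntegral_bessel`). Both
sides behave like `(2i/π) (log (t/2) + γ) + 1` at the origin; for the integral this comes from
integrating by parts against the primitive `2 log (√s + √(s - 2i))` and from
`∫₀^∞ e^{-v} log v dv = -γ`. Their difference is a solution `f` with `f → 0` and `t f' → 0` at the
origin, and an energy argument shows that it vanishes (`bessel_solution_eq_zero`).

With `R = |x - y|` and `c = ∂R/∂r`, the cosine of the angle between `x - y` and `x - (0, H)`, the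
kernel `K` is bounded by a multiple of `R^(-1/2) (1/R + (1 - c))` (`exists_kernel_bounds`), and
the identity `2 (|a| |b| - a · b) = |a - b|² - (|a| - |b|)²` gives `1 - c ≤ t² / (2 R r)`. This
yields the pointwise bounds, and also `|K| = O(r^(-3/2) (1 + t²)²)` for all `t`, because
`r ≤ R (1 + |t|/h)`.
The decay of the density absorbs the polynomial factor, and the gradient of `S` is bounded away from
the line, so that the potential may be differentiated under the integral sign.
-/

open Filter Topology MeasureTheory Set

/-! ### Power series with factorially small coefficients -/

/-- The sum of the power series with real coefficients `c`. -/
noncomputable def powSeries (c : ℕ → ℝ) (w : ℝ) : ℝ := ∑' m : ℕ, c m * w ^ m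

/-- The coefficients of the termwise derivative of the power series with coefficients `c`. -/
noncomputable def derivCoeff (c : ℕ → ℝ) (m : ℕ) : ℝ := (m + 1) * c (m + 1)

/-- Coefficients bounded by `1 / m!`. This class is stable under termwise differentiation. -/
noncomputable def FactorialDecay (c : ℕ → ℝ) : Prop := ∀ m, |c m| ≤ 1 / (m.factorial : ℝ)

theorem FactorialDecay.derivCoeff {c : ℕ → ℝ} (hc : FactorialDecay c) :
    FactorialDecay (derivCoeff c) := by
  intro m
  have h := hc (m + 1)
  have hm : (0 : ℝ) < m + 1 := by positivity
  have hf : (0 : ℝ) < m.factorial := by positivity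
  rw [_root_.derivCoeff, abs_mul, abs_of_pos hm]
  calc (m + 1 : ℝ) * |c (m + 1)| ≤ (m + 1) * (1 / ((m + 1).factorial : ℝ)) := by gcongr
    _ = 1 / m.factorial := by
      rw [Nat.factorial_succ]; push_cast; field_simp

theorem FactorialDecay.summable {c : ℕ → ℝ} (hc : FactorialDecay c) (w : ℝ) :
    Summable fun m => c m * w ^ m := by
  refine Summable.of_norm_bounded (Real.summable_pow_div_factorial |w|) fun m => ?_
  rw [Real.norm_eq_abs, abs_mul, abs_pow, div_eq_inv_mul, ← one_div]
  gcongr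
  exact hc m

theorem FactorialDecay.hasDerivAt {c : ℕ → ℝ} (hc : FactorialDecay c) (w : ℝ) :
    HasDerivAt (powSeries c) (powSeries (_root_.derivCoeff c) w) w := by
  set R : ℝ := |w| + 1
  have hR : 0 ≤ R := by positivity
  have hu : Summable fun m : ℕ => 1 / (m.factorial : ℝ) * (m * R ^ (m - 1)) := by
    rw [← summable_nat_add_iff 1]
    refine (Real.summable_pow_div_factorial R).congr fun m => ?_
    rw [Nat.factorial_succ]; push_cast
    field_simp
  have key := hasDerivAt_tsum_of_isPreconnected (g := fun m z => c m * z ^ m)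
    (g' := fun m z => c m * (m * z ^ (m - 1))) hu (Metric.isOpen_ball (x := (0 : ℝ)) (ε := R))
    (convex_ball (0 : ℝ) R).isPreconnected
    (fun m y _ => (hasDerivAt_pow m y).const_mul (c m))
    (fun m y hy => by
      have hy' : |y| ≤ R := by simpa using (mem_ball_zero_iff.1 hy).le
      rw [Real.norm_eq_abs, abs_mul, abs_mul, abs_pow, Nat.abs_cast]
      gcongr
      exact hc m)
    (Metric.mem_ball_self (by positivity)) (hc.summable 0)
    (show w ∈ Metric.ball (0 : ℝ) R by simp [R])
  have hs : Summable fun m : ℕ => c m * (m * w ^ (m - 1)) := by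
    rw [← summable_nat_add_iff 1]
    refine (hc.derivCoeff.summable w).congr fun m => ?_
    simp only [_root_.derivCoeff, Nat.add_sub_cancel]; push_cast; ring
  refine key.congr_deriv ?_
  rw [hs.tsum_eq_zero_add]
  simp only [CharP.cast_eq_zero, zero_mul, mul_zero, zero_add, powSeries, _root_.derivCoeff,
    Nat.add_sub_cancel]
  refine tsum_congr fun m => ?_
  push_cast; ring

theorem powSeries_zero (c : ℕ → ℝ) : powSeries c 0 = c 0 := by
  rw [powSeries, tsum_eq_single 0 (fun m hm => by simp [hm])]
  simp

/-- The operator `w f'' + f' + f`, which is Bessel's operator of order zero in the variable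
`w = t² / 4`, acts on coefficients by `c ↦ (m + 1)² c (m + 1) + c m`. -/
theorem FactorialDecay.besselOp {c : ℕ → ℝ} (hc : FactorialDecay c) (w : ℝ) :
    w * powSeries (_root_.derivCoeff (_root_.derivCoeff c)) w + powSeries (_root_.derivCoeff c) w
      + powSeries c w = powSeries (fun m => ((m : ℝ) + 1) ^ 2 * c (m + 1) + c m) w := by
  have h1 := hc.derivCoeff.summable w
  have h2 := hc.derivCoeff.derivCoeff.summable w
  have h3 : Summable fun m : ℕ => (m : ℝ) * _root_.derivCoeff c m * w ^ m := by
    rw [← summable_nat_add_iff 1]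
    refine (h2.mul_left w).congr fun m => ?_
    simp only [_root_.derivCoeff]; push_cast; ring
  have h4 : w * powSeries (_root_.derivCoeff (_root_.derivCoeff c)) w
      = ∑' m : ℕ, (m : ℝ) * _root_.derivCoeff c m * w ^ m := by
    rw [h3.tsum_eq_zero_add, powSeries, ← tsum_mul_left]
    simp only [CharP.cast_eq_zero, zero_mul, zero_add]
    refine tsum_congr fun m => ?_
    simp only [_root_.derivCoeff]; push_cast; ring
  rw [h4]
  unfold powSeries
  rw [← h3.tsum_add h1, ← (h3.add h1).tsum_add (hc.summable w)]
  refine tsum_congr fun m => ?_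
  simp only [_root_.derivCoeff]; ring

/-! ### Bessel functions of order zero near the origin -/

/-- Coefficients of `J₀` in the variable `t² / 4`. -/
noncomputable def besselCoeff (m : ℕ) : ℝ := (-1) ^ m / (m.factorial : ℝ) ^ 2

/-- Coefficients, in the variable `t² / 4`, of the regular part of `Y₀`. -/
noncomputable def neumannCoeff (m : ℕ) : ℝ :=
  (-1) ^ m * ((harmonic m : ℚ) : ℝ) / (m.factorial : ℝ) ^ 2

theorem one_le_cast_factorial (m : ℕ) : (1 : ℝ) ≤ m.factorial := by
  exact_mod_cast Nat.one_le_iff_ne_zero.2 m.factorial_ne_zero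

theorem factorialDecay_besselCoeff : FactorialDecay besselCoeff := by
  intro m
  have h := one_le_cast_factorial m
  rw [besselCoeff, abs_div, abs_pow, abs_neg, abs_one, one_pow, abs_of_pos (by positivity)]
  gcongr
  nlinarith

theorem abs_harmonic_le_factorial (m : ℕ) : |((harmonic m : ℚ) : ℝ)| ≤ m.factorial := by
  induction m with
  | zero => simp
  | succ n ih =>
    rw [harmonic_succ]
    rcases Nat.eq_zero_or_pos n with rfl | hn
    · simp
    · have h := one_le_cast_factorial n
      have hn' : (1 : ℝ) ≤ n := by exact_mod_cast hn
      push_cast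
      refine (abs_add_le _ _).trans ?_
      have h1 : |((n : ℝ) + 1)⁻¹| ≤ 1 := by
        rw [abs_of_pos (by positivity)]
        exact inv_le_one_of_one_le₀ (by linarith)
      rw [Nat.factorial_succ]
      push_cast
      nlinarith

theorem factorialDecay_neumannCoeff : FactorialDecay neumannCoeff := by
  intro m
  have h := one_le_cast_factorial m
  rw [neumannCoeff, abs_div, abs_mul, abs_pow, abs_neg, abs_one, one_pow, one_mul,
    abs_of_pos (by positivity : (0 : ℝ) < (m.factorial : ℝ) ^ 2)]
  rw [div_le_div_iff₀ (by positivity) (by positivity)]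
  nlinarith [abs_harmonic_le_factorial m]

theorem besselJZero_eq (t : ℝ) : besselJZero t = powSeries besselCoeff (t ^ 2 / 4) :=
  tsum_congr fun m => by rw [besselCoeff]; ring

/-- Bessel's equation for `J₀`, in the variable `w = t² / 4`. -/
theorem besselOp_besselCoeff (w : ℝ) :
    w * powSeries (derivCoeff (derivCoeff besselCoeff)) w + powSeries (derivCoeff besselCoeff) w
      + powSeries besselCoeff w = 0 := by
  rw [factorialDecay_besselCoeff.besselOp]
  have : (fun m : ℕ => ((m : ℝ) + 1) ^ 2 * besselCoeff (m + 1) + besselCoeff m) = fun _ => 0 := by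
    ext m
    have : (m.factorial : ℝ) ≠ 0 := by positivity
    simp only [besselCoeff, Nat.factorial_succ]
    push_cast
    field_simp
    ring
  rw [this]
  simp [powSeries]

/-- The regular part of `Y₀` solves an inhomogeneous Bessel equation, whose right-hand side
compensates the logarithm. -/
theorem besselOp_neumannCoeff (w : ℝ) :
    w * powSeries (derivCoeff (derivCoeff neumannCoeff)) w + powSeries (derivCoeff neumannCoeff) w
      + powSeries neumannCoeff w = powSeries (derivCoeff besselCoeff) w := by
  rw [factorialDecay_neumannCoeff.besselOp]
  congr 1
  ext m
  have : (m.factorial : ℝ) ≠ 0 := by positivity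
  simp only [derivCoeff, besselCoeff, neumannCoeff, Nat.factorial_succ, harmonic_succ]
  push_cast
  field_simp
  ring

theorem hasDerivAt_sq_div_four (t : ℝ) : HasDerivAt (fun t : ℝ => t ^ 2 / 4) (t / 2) t := by
  refine ((hasDerivAt_pow 2 t).div_const 4).congr_deriv ?_
  push_cast; ring

theorem FactorialDecay.hasDerivAt_comp {c : ℕ → ℝ} (hc : FactorialDecay c) (t : ℝ) :
    HasDerivAt (fun t => powSeries c (t ^ 2 / 4))
      (t / 2 * powSeries (_root_.derivCoeff c) (t ^ 2 / 4)) t := by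
  refine ((hc.hasDerivAt (t ^ 2 / 4)).comp t (hasDerivAt_sq_div_four t)).congr_deriv ?_
  ring

theorem FactorialDecay.hasDerivAt_deriv_comp {c : ℕ → ℝ} (hc : FactorialDecay c) (t : ℝ) :
    HasDerivAt (fun t => t / 2 * powSeries (_root_.derivCoeff c) (t ^ 2 / 4))
      (powSeries (_root_.derivCoeff c) (t ^ 2 / 4) / 2
        + t ^ 2 / 4 * powSeries (_root_.derivCoeff (_root_.derivCoeff c)) (t ^ 2 / 4)) t := by
  refine (((hasDerivAt_id t).div_const 2).mul (hc.derivCoeff.hasDerivAt_comp t)).congr_deriv ?_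
  simp only [id]; ring

theorem FactorialDecay.continuous {c : ℕ → ℝ} (hc : FactorialDecay c) : Continuous (powSeries c) :=
  continuous_iff_continuousAt.2 fun w => (hc.hasDerivAt w).continuousAt

/-- `(π / 2) Y₀`. -/
noncomputable def neumannPart (t : ℝ) : ℝ :=
  (Real.log (t / 2) + Real.eulerMascheroniConstant) * powSeries besselCoeff (t ^ 2 / 4)
    - powSeries neumannCoeff (t ^ 2 / 4)

theorem besselYZero_eq (t : ℝ) : besselYZero t = 2 / Real.pi * neumannPart t := by
  rw [besselYZero, besselJZero_eq, neumannPart, mul_sub, mul_assoc]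
  congr 2
  exact tsum_congr fun m => by rw [neumannCoeff]; ring

/-- The derivative of `(π / 2) Y₀`. -/
noncomputable def neumannPartDeriv (t : ℝ) : ℝ :=
  1 / t * powSeries besselCoeff (t ^ 2 / 4)
    + (Real.log (t / 2) + Real.eulerMascheroniConstant)
      * (t / 2 * powSeries (derivCoeff besselCoeff) (t ^ 2 / 4))
    - t / 2 * powSeries (derivCoeff neumannCoeff) (t ^ 2 / 4)

theorem hasDerivAt_log_half_add (a : ℝ) {t : ℝ} (ht : 0 < t) :
    HasDerivAt (fun t => Real.log (t / 2) + a) (1 / t) t := by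
  have h := ((((hasDerivAt_id t).div_const 2).log (by simp; positivity)).add_const a)
  refine h.congr_deriv ?_
  simp only [id]; field_simp

theorem hasDerivAt_neumannPart {t : ℝ} (ht : 0 < t) :
    HasDerivAt neumannPart (neumannPartDeriv t) t :=
  ((hasDerivAt_log_half_add _ ht).mul (factorialDecay_besselCoeff.hasDerivAt_comp t)).sub
    (factorialDecay_neumannCoeff.hasDerivAt_comp t)

/-- `(π / 2) Y₀` solves Bessel's equation. -/
theorem hasDerivAt_neumannPartDeriv {t : ℝ} (ht : 0 < t) :
    HasDerivAt neumannPartDeriv (-neumannPart t - neumannPartDeriv t / t) t := by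
  have hinv : HasDerivAt (fun t : ℝ => 1 / t) (-1 / t ^ 2) t := by
    simpa using (hasDerivAt_inv ht.ne').congr_deriv (by ring : -(t ^ 2)⁻¹ = -1 / t ^ 2)
  have h := ((hinv.mul (factorialDecay_besselCoeff.hasDerivAt_comp t)).add
    ((hasDerivAt_log_half_add Real.eulerMascheroniConstant ht).mul
      (factorialDecay_besselCoeff.hasDerivAt_deriv_comp t))).sub
    (factorialDecay_neumannCoeff.hasDerivAt_deriv_comp t)
  refine h.congr_deriv ?_
  have e1 := besselOp_besselCoeff (t ^ 2 / 4)
  have e2 := besselOp_neumannCoeff (t ^ 2 / 4)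
  simp only [neumannPart, neumannPartDeriv]
  field_simp
  linear_combination (Real.log (t / 2) + Real.eulerMascheroniConstant) * 8 * t ^ 2 * e1
    - 8 * t ^ 2 * e2

theorem hasDerivAt_besselJZero_deriv {t : ℝ} (ht : 0 < t) :
    HasDerivAt (fun t => t / 2 * powSeries (derivCoeff besselCoeff) (t ^ 2 / 4))
      (-powSeries besselCoeff (t ^ 2 / 4)
        - (t / 2 * powSeries (derivCoeff besselCoeff) (t ^ 2 / 4)) / t) t := by
  refine (factorialDecay_besselCoeff.hasDerivAt_deriv_comp t).congr_deriv ?_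
  have e1 := besselOp_besselCoeff (t ^ 2 / 4)
  field_simp
  linear_combination 8 * e1

theorem FactorialDecay.tendsto_comp {c : ℕ → ℝ} (hc : FactorialDecay c) :
    Tendsto (fun t : ℝ => powSeries c (t ^ 2 / 4)) (𝓝[>] 0) (𝓝 (c 0)) := by
  have : Continuous fun t : ℝ => powSeries c (t ^ 2 / 4) :=
    hc.continuous.comp (by fun_prop)
  have h := this.tendsto 0
  simp only [ne_eq, OfNat.ofNat_ne_zero, not_false_eq_true, zero_pow, zero_div,
    powSeries_zero] at h
  exact h.mono_left nhdsWithin_le_nhds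

theorem tendsto_log_half_mul_self (a : ℝ) :
    Tendsto (fun t : ℝ => (Real.log (t / 2) + a) * t) (𝓝[>] 0) (𝓝 0) := by
  have h1 : Tendsto (fun t : ℝ => Real.log t * t) (𝓝[>] 0) (𝓝 0) :=
    (tendsto_log_mul_rpow_nhdsGT_zero one_pos).congr fun t => by rw [Real.rpow_one]
  have h2 : Tendsto (fun t : ℝ => (a - Real.log 2) * t) (𝓝[>] 0) (𝓝 0) := by
    have := (continuous_const_mul (a - Real.log 2)).tendsto 0
    rw [mul_zero] at this
    exact this.mono_left nhdsWithin_le_nhds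
  have h := h1.add h2
  rw [add_zero] at h
  refine h.congr' ?_
  filter_upwards [self_mem_nhdsWithin] with t ht
  rw [Real.log_div (ne_of_gt ht) two_ne_zero]; ring

theorem tendsto_neumannPart_sub_log :
    Tendsto (fun t => neumannPart t - (Real.log (t / 2) + Real.eulerMascheroniConstant))
      (𝓝[>] 0) (𝓝 0) := by
  -- `(log (t / 2) + γ) (J₀ - 1)` tends to zero since `J₀ - 1 = O(t)`
  have hs : Tendsto (fun t : ℝ => t⁻¹ * (powSeries besselCoeff (t ^ 2 / 4) - 1)) (𝓝[>] 0)
      (𝓝 0) := by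
    have h := (factorialDecay_besselCoeff.hasDerivAt_comp 0).tendsto_slope_zero_right
    simpa [powSeries_zero, besselCoeff] using h
  have h1 := (tendsto_log_half_mul_self Real.eulerMascheroniConstant).mul hs
  have h2 := h1.sub factorialDecay_neumannCoeff.tendsto_comp
  simp only [neumannCoeff, mul_zero, pow_zero, harmonic_zero, Rat.cast_zero, zero_div,
    sub_zero] at h2
  refine h2.congr' ?_
  filter_upwards [self_mem_nhdsWithin] with t ht
  have : t ≠ 0 := ne_of_gt ht
  rw [neumannPart]; field_simp; ring

theorem tendsto_mul_neumannPartDeriv :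
    Tendsto (fun t => t * neumannPartDeriv t) (𝓝[>] 0) (𝓝 1) := by
  have hid : Tendsto (fun t : ℝ => t) (𝓝[>] 0) (𝓝 0) := nhdsWithin_le_nhds
  have h1 := factorialDecay_besselCoeff.tendsto_comp
  have h2 := ((tendsto_log_half_mul_self Real.eulerMascheroniConstant).mul
    (hid.mul factorialDecay_besselCoeff.derivCoeff.tendsto_comp)).div_const 2
  have h3 := ((hid.mul hid).mul factorialDecay_neumannCoeff.derivCoeff.tendsto_comp).div_const 2
  have h := (h1.add h2).sub h3
  simp only [besselCoeff, Nat.factorial_zero, Nat.cast_one, pow_zero, one_pow, div_one, zero_mul,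
    zero_div, add_zero, sub_zero] at h
  refine h.congr' ?_
  filter_upwards [self_mem_nhdsWithin] with t ht
  have : t ≠ 0 := ne_of_gt ht
  rw [neumannPartDeriv]
  field_simp

/-! ### A Laplace integral solving Bessel's equation -/

/-- The branch of `√(s - 2i)` with positive real part. -/
noncomputable def rootShift (s : ℝ) : ℂ := ((s : ℂ) - 2 * Complex.I) ^ (((2 : ℕ) : ℂ)⁻¹)

theorem shift_mem_slitPlane (s : ℝ) : (s : ℂ) - 2 * Complex.I ∈ Complex.slitPlane :=
  Or.inr (by simp)

theorem rootShift_sq (s : ℝ) : rootShift s ^ 2 = s - 2 * Complex.I :=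
  Complex.cpow_nat_inv_pow _ two_ne_zero

theorem rootShift_eq_exp (s : ℝ) :
    rootShift s = Complex.exp (Complex.log ((s : ℂ) - 2 * Complex.I) / 2) := by
  rw [rootShift, Complex.cpow_def_of_ne_zero (Complex.slitPlane_ne_zero (shift_mem_slitPlane s))]
  push_cast; rw [div_eq_mul_inv]

theorem rootShift_re_pos (s : ℝ) : 0 < (rootShift s).re := by
  rw [rootShift_eq_exp, Complex.exp_re]
  have h1 := Complex.neg_pi_lt_arg ((s : ℂ) - 2 * Complex.I)
  have h2 := (Complex.mem_slitPlane_iff_arg.1 (shift_mem_slitPlane s)).1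
  have h3 := lt_of_le_of_ne (Complex.arg_le_pi ((s : ℂ) - 2 * Complex.I)) h2
  refine mul_pos (Real.exp_pos _) (Real.cos_pos_of_mem_Ioo ⟨?_, ?_⟩) <;>
  · rw [Complex.div_ofNat_im, Complex.log_im]; linarith

theorem rootShift_ne_zero (s : ℝ) : rootShift s ≠ 0 := fun h => by
  have := rootShift_re_pos s
  simp [h] at this

theorem hasDerivAt_rootShift (s : ℝ) : HasDerivAt rootShift (1 / (2 * rootShift s)) s := by
  have h0 : HasDerivAt (fun s : ℝ => (s : ℂ) - 2 * Complex.I) 1 s :=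
    Complex.ofRealCLM.hasDerivAt.sub_const _
  have h := ((h0.clog_real (shift_mem_slitPlane s)).div_const 2).cexp
  have hE : rootShift = fun s : ℝ => Complex.exp (Complex.log ((s : ℂ) - 2 * Complex.I) / 2) :=
    funext rootShift_eq_exp
  rw [hE]
  refine h.congr_deriv ?_
  rw [← rootShift_eq_exp, ← rootShift_sq]
  have := rootShift_ne_zero s
  field_simp
  exact (rootShift_eq_exp s).symm

theorem continuous_rootShift : Continuous rootShift :=
  continuous_iff_continuousAt.2 fun s => (hasDerivAt_rootShift s).continuousAt

theorem norm_rootShift_sq (s : ℝ) : ‖rootShift s‖ ^ 2 = ‖(s : ℂ) - 2 * Complex.I‖ := by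
  rw [← norm_pow, rootShift_sq]

theorem one_le_norm_rootShift (s : ℝ) : 1 ≤ ‖rootShift s‖ := by
  have h := Complex.abs_im_le_norm ((s : ℂ) - 2 * Complex.I)
  rw [← norm_rootShift_sq] at h
  simp at h
  nlinarith [norm_nonneg (rootShift s)]

theorem sqrt_le_norm_rootShift (s : ℝ) : √s ≤ ‖rootShift s‖ := by
  have h := (le_abs_self _).trans (Complex.abs_re_le_norm ((s : ℂ) - 2 * Complex.I))
  rw [← norm_rootShift_sq] at h
  simp at h
  exact Real.sqrt_le_iff.2 ⟨norm_nonneg _, h⟩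

theorem norm_rootShift_le {s : ℝ} (hs : 0 ≤ s) : ‖rootShift s‖ ≤ √s + 2 := by
  have h := norm_sub_le (s : ℂ) (2 * Complex.I)
  rw [← norm_rootShift_sq] at h
  simp [abs_of_nonneg hs] at h
  have := Real.sq_sqrt hs
  have := Real.sqrt_nonneg s
  exact abs_le_of_sq_le_sq' (by nlinarith) (by positivity) |>.2

/-- The weight `1 / √(s (s - 2i))` of the Laplace integral. -/
noncomputable def laplaceWeight (s : ℝ) : ℂ := 1 / ((√s : ℂ) * rootShift s)

theorem norm_laplaceWeight_le {s : ℝ} (hs : 0 < s) : ‖laplaceWeight s‖ ≤ s ^ (1 / 2 - 1 : ℝ) := by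
  have h1 := one_le_norm_rootShift s
  have h2 : s ^ (1 / 2 - 1 : ℝ) = 1 / √s := by
    rw [Real.sqrt_eq_rpow, one_div (s ^ _), ← Real.rpow_neg hs.le]; norm_num
  have h3 := Real.sqrt_pos.2 hs
  rw [h2, laplaceWeight, norm_div, norm_mul, norm_one, Complex.norm_real, Real.norm_eq_abs,
    abs_of_pos h3]
  gcongr
  nlinarith

theorem continuousOn_laplaceWeight : ContinuousOn laplaceWeight (Ioi 0) := by
  unfold laplaceWeight
  refine continuousOn_const.div ?_ fun s hs => ?_
  · exact ((Complex.continuous_ofReal.comp Real.continuous_sqrt).mul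
      continuous_rootShift).continuousOn
  · exact mul_ne_zero (by exact_mod_cast (Real.sqrt_pos.2 hs).ne') (rootShift_ne_zero s)

/-- The integrand of `hankelIntegral`. -/
noncomputable def hankelIntegrand (n : ℕ) (z s : ℝ) : ℂ :=
  (Complex.I - s) ^ n * Complex.exp (z * (Complex.I - s)) * laplaceWeight s

/-- The `n`-th derivative of `z ↦ ∫₀^∞ e^{z (i - s)} / √(s (s - 2i)) ds`; the function itself is
`(π i / 2) H₀⁽¹⁾`. -/
noncomputable def hankelIntegral (n : ℕ) (z : ℝ) : ℂ := ∫ s in Ioi (0 : ℝ), hankelIntegrand n z s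

theorem norm_cexp_mul_I_sub (z s : ℝ) :
    ‖Complex.exp (z * (Complex.I - s))‖ = Real.exp (-(z * s)) := by
  rw [Complex.norm_exp]; simp

theorem norm_I_sub_le {s : ℝ} (hs : 0 ≤ s) : ‖Complex.I - (s : ℂ)‖ ≤ 1 + s := by
  have := norm_sub_le Complex.I (s : ℂ)
  simpa [abs_of_nonneg hs] using this

theorem norm_hankelIntegrand_le (n : ℕ) (z : ℝ) {s : ℝ} (hs : 0 < s) :
    ‖hankelIntegrand n z s‖ ≤ (1 + s) ^ n * (s ^ (1 / 2 - 1 : ℝ) * Real.exp (-(z * s))) := by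
  rw [hankelIntegrand, norm_mul, norm_mul, norm_cexp_mul_I_sub, norm_pow, mul_assoc,
    mul_comm (Real.exp _)]
  gcongr
  · exact norm_I_sub_le hs.le
  · exact norm_laplaceWeight_le hs

theorem continuousOn_hankelIntegrand (n : ℕ) (z : ℝ) :
    ContinuousOn (hankelIntegrand n z) (Ioi 0) := by
  unfold hankelIntegrand
  exact ContinuousOn.mul (by fun_prop) continuousOn_laplaceWeight

theorem integrableOn_rpow_mul_exp {a r : ℝ} (ha : 0 < a) (hr : 0 < r) :
    IntegrableOn (fun s : ℝ => s ^ (a - 1) * Real.exp (-(r * s))) (Ioi 0) := by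
  have h := integrableOn_rpow_mul_exp_neg_mul_rpow (p := 1) (s := a - 1) (b := r)
    (by linarith) one_pos hr
  simpa [Real.rpow_one, neg_mul] using h

theorem pow_mul_rpow_sub_one (n : ℕ) {a s : ℝ} (hs : 0 < s) :
    s ^ n * s ^ (a - 1) = s ^ (n + a - 1) := by
  rw [← Real.rpow_natCast, ← Real.rpow_add hs]; ring_nf

theorem integrableOn_hankelBound (n : ℕ) {r : ℝ} (hr : 0 < r) :
    IntegrableOn (fun s : ℝ => (1 + s) ^ n * (s ^ (1 / 2 - 1 : ℝ) * Real.exp (-(r * s))))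
      (Ioi 0) := by
  have h := ((integrableOn_rpow_mul_exp (a := 1 / 2) (by norm_num) hr).add
    (integrableOn_rpow_mul_exp (a := n + 1 / 2) (by positivity) hr)).const_mul (2 ^ (n - 1))
  refine Integrable.mono' h ?_ ?_
  · refine ContinuousOn.aestronglyMeasurable ?_ measurableSet_Ioi
    refine ContinuousOn.mul (by fun_prop) (ContinuousOn.mul ?_ (by fun_prop))
    exact fun s hs => (Real.continuousAt_rpow_const _ _ (Or.inl (ne_of_gt hs))).continuousWithinAt
  · refine (ae_restrict_iff' measurableSet_Ioi).2 (ae_of_all _ fun s hs => ?_)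
    have hs : 0 < s := hs
    have h1 := add_pow_le zero_le_one hs.le n
    rw [Real.norm_eq_abs, abs_of_nonneg (by positivity)]
    simp only [Pi.add_apply]
    rw [← pow_mul_rpow_sub_one n hs, mul_assoc (s ^ n), ← one_add_mul]
    rw [one_pow] at h1
    rw [← mul_assoc (2 ^ (n - 1) : ℝ)]
    exact mul_le_mul_of_nonneg_right h1 (by positivity)

theorem integrableOn_hankelIntegrand (n : ℕ) {z : ℝ} (hz : 0 < z) :
    IntegrableOn (hankelIntegrand n z) (Ioi 0) :=
  Integrable.mono' (integrableOn_hankelBound n hz)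
    ((continuousOn_hankelIntegrand n z).aestronglyMeasurable measurableSet_Ioi)
    ((ae_restrict_iff' measurableSet_Ioi).2 (ae_of_all _ fun _ hs =>
      norm_hankelIntegrand_le n z hs))

theorem hasDerivAt_hankelIntegral (n : ℕ) {z : ℝ} (hz : 0 < z) :
    HasDerivAt (hankelIntegral n) (hankelIntegral (n + 1) z) z := by
  refine (hasDerivAt_integral_of_dominated_loc_of_deriv_le (F := hankelIntegrand n)
    (F' := hankelIntegrand (n + 1)) (s := Ioi (z / 2))
    (bound := fun s => (1 + s) ^ (n + 1) * (s ^ (1 / 2 - 1 : ℝ) * Real.exp (-(z / 2 * s))))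
    (Ioi_mem_nhds (by linarith)) (.of_forall fun z =>
      (continuousOn_hankelIntegrand n z).aestronglyMeasurable measurableSet_Ioi)
    (integrableOn_hankelIntegrand n hz)
    ((continuousOn_hankelIntegrand (n + 1) z).aestronglyMeasurable measurableSet_Ioi) ?_
    (integrableOn_hankelBound (n + 1) (by linarith)) ?_).2
  · refine (ae_restrict_iff' measurableSet_Ioi).2 (ae_of_all _ fun s hs y hy => ?_)
    have hs : 0 < s := hs
    have hy : z / 2 < y := hy
    refine (norm_hankelIntegrand_le (n + 1) y hs).trans ?_
    gcongr
  · refine ae_of_all _ fun s y _ => ?_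
    have h : HasDerivAt (fun y : ℝ => (y : ℂ) * (Complex.I - s)) (Complex.I - s) y := by
      simpa using (Complex.ofRealCLM.hasDerivAt (x := y)).mul_const (Complex.I - (s : ℂ))
    refine ((h.cexp.const_mul ((Complex.I - s) ^ n)).mul_const (laplaceWeight s)).congr_deriv ?_
    rw [hankelIntegrand]; ring

theorem tendsto_affine_mul_exp_neg (A B : ℝ) {r : ℝ} (hr : 0 < r) :
    Tendsto (fun s : ℝ => (A + B * s) * Real.exp (-(r * s))) atTop (𝓝 0) := by
  have h0 := (tendsto_rpow_mul_exp_neg_mul_atTop_nhds_zero 0 r hr).const_mul A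
  have h1 := (tendsto_rpow_mul_exp_neg_mul_atTop_nhds_zero 1 r hr).const_mul B
  have h := h0.add h1
  simp only [Real.rpow_zero, Real.rpow_one, mul_zero, add_zero] at h
  refine h.congr fun s => ?_
  rw [neg_mul]; ring

/-- Bessel's equation for the Laplace integral: the integrand of the left-hand side is the
derivative of `-e^{z (i - s)} √(s (s - 2i))`, which vanishes at both ends. -/
theorem hankelIntegral_bessel {z : ℝ} (hz : 0 < z) :
    z * hankelIntegral 2 z + hankelIntegral 1 z + z * hankelIntegral 0 z = 0 := by
  have i0 := integrableOn_hankelIntegrand 0 hz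
  have i1 := integrableOn_hankelIntegrand 1 hz
  have i2 := integrableOn_hankelIntegrand 2 hz
  have isum := ((i2.const_mul (z : ℂ)).add i1).add (i0.const_mul (z : ℂ))
  have hder : ∀ s ∈ Ioi (0 : ℝ), HasDerivAt
      (fun s : ℝ => -(Complex.exp (z * (Complex.I - s)) * ((√s : ℂ) * rootShift s)))
      (z * hankelIntegrand 2 z s + hankelIntegrand 1 z s + z * hankelIntegrand 0 z s) s := by
    intro s hs
    have hs : 0 < s := hs
    have hq : (√s : ℂ) ^ 2 = s := by exact_mod_cast Real.sq_sqrt hs.le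
    have hq0 : (√s : ℂ) ≠ 0 := by exact_mod_cast (Real.sqrt_pos.2 hs).ne'
    have hr0 := rootShift_ne_zero s
    have hr := rootShift_sq s
    have h1 : HasDerivAt (fun s : ℝ => (z : ℂ) * (Complex.I - s)) (-z) s := by
      simpa using ((Complex.ofRealCLM.hasDerivAt (x := s)).const_sub Complex.I).const_mul (z : ℂ)
    have h2 : HasDerivAt (fun s : ℝ => (√s : ℂ)) ((1 / (2 * √s) : ℝ) : ℂ) s :=
      (Real.hasDerivAt_sqrt hs.ne').ofReal_comp
    refine (h1.cexp.mul (h2.mul (hasDerivAt_rootShift s))).neg.congr_deriv ?_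
    simp only [hankelIntegrand, laplaceWeight, Pi.mul_apply]
    push_cast
    have hI : Complex.I ^ 2 = -1 := Complex.I_sq
    field_simp
    linear_combination 2 * z * (rootShift s ^ 2 * hq + s * hr) - hq - hr - 2 * z * hI
  have hcont : ContinuousWithinAt
      (fun s : ℝ => -(Complex.exp (z * (Complex.I - s)) * ((√s : ℂ) * rootShift s))) (Ici 0) 0 := by
    have := continuous_rootShift
    exact Continuous.continuousWithinAt (by fun_prop)
  have hlim : Tendsto
      (fun s : ℝ => -(Complex.exp (z * (Complex.I - s)) * ((√s : ℂ) * rootShift s)))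
      atTop (𝓝 0) := by
    refine squeeze_zero_norm' ?_ (tendsto_affine_mul_exp_neg 2 3 hz)
    filter_upwards [eventually_ge_atTop 0] with s hs
    have h1 := Real.sq_sqrt hs
    have h2 := Real.sqrt_nonneg s
    rw [norm_neg, norm_mul, norm_mul, norm_cexp_mul_I_sub, Complex.norm_real, Real.norm_eq_abs,
      abs_of_nonneg h2, mul_comm]
    gcongr
    nlinarith [mul_le_mul_of_nonneg_left (norm_rootShift_le hs) h2, sq_nonneg (√s - 1)]
  have h := integral_Ioi_of_hasDerivAt_of_tendsto hcont hder isum hlim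
  have e : ∫ s in Ioi (0 : ℝ), (z * hankelIntegrand 2 z s + hankelIntegrand 1 z s
      + z * hankelIntegrand 0 z s)
      = z * hankelIntegral 2 z + hankelIntegral 1 z + z * hankelIntegral 0 z := by
    have i21 : IntegrableOn (fun s => z * hankelIntegrand 2 z s + hankelIntegrand 1 z s)
      (Ioi 0) := (i2.const_mul (z : ℂ)).add i1
    rw [integral_add i21 (i0.const_mul (z : ℂ)), integral_add (i2.const_mul (z : ℂ)) i1,
      integral_const_mul, integral_const_mul]
    rfl
  rw [← e, h]
  simp

theorem integral_rpow_mul_exp {a r : ℝ} (ha : 0 < a) (hr : 0 < r) :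
    ∫ s in Ioi (0 : ℝ), s ^ (a - 1) * Real.exp (-(r * s)) = Real.Gamma a * r ^ (-a) := by
  rw [Real.integral_rpow_mul_exp_neg_mul_Ioi ha hr, one_div, Real.inv_rpow hr.le,
    Real.rpow_neg hr.le, mul_comm]

/-- If the integrand is at most `s ^ n (1 + s) s ^ (-1/2) e^{-z s}`, then the integral decays
like `z ^ (-n - 1/2)` away from the origin. -/
theorem exists_norm_integral_le (n : ℕ) {a : ℝ} (ha : 0 < a) : ∃ C, ∀ z, a ≤ z → ∀ f : ℝ → ℂ,
    (∀ s, 0 < s → ‖f s‖ ≤ s ^ n * ((1 + s) * (s ^ (1 / 2 - 1 : ℝ) * Real.exp (-(z * s))))) →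
    ‖∫ s in Ioi (0 : ℝ), f s‖ ≤ C * z ^ (-(n + 1 / 2) : ℝ) := by
  refine ⟨Real.Gamma (n + 1 / 2) + Real.Gamma (n + 1 / 2 + 1) / a, fun z hz f hf => ?_⟩
  have hz0 : 0 < z := ha.trans_le hz
  have hn : (0 : ℝ) < n + 1 / 2 := by positivity
  have hn1 : (0 : ℝ) < n + 1 / 2 + 1 := by positivity
  have i1 := integrableOn_rpow_mul_exp hn hz0
  have i2 := integrableOn_rpow_mul_exp hn1 hz0
  have hle : ‖∫ s in Ioi (0 : ℝ), f s‖ ≤ ∫ s in Ioi (0 : ℝ),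
      (s ^ ((n : ℝ) + 1 / 2 - 1) * Real.exp (-(z * s))
        + s ^ ((n : ℝ) + 1 / 2 + 1 - 1) * Real.exp (-(z * s))) := by
    refine norm_integral_le_of_norm_le (i1.add i2)
      ((ae_restrict_iff' measurableSet_Ioi).2 (ae_of_all _ fun s hs => ?_))
    have hs : 0 < s := hs
    refine (hf s hs).trans_eq ?_
    rw [show (n : ℝ) + 1 / 2 + 1 - 1 = ((n : ℝ) + 1 / 2 - 1) + 1 by ring, Real.rpow_add_one hs.ne',
      ← pow_mul_rpow_sub_one n hs]
    ring
  rw [integral_add i1 i2, integral_rpow_mul_exp hn hz0, integral_rpow_mul_exp hn1 hz0] at hle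
  refine hle.trans ?_
  have e : z ^ (-(n + 1 / 2 + 1) : ℝ) = z ^ (-(n + 1 / 2) : ℝ) / z := by
    rw [← Real.rpow_sub_one hz0.ne']; ring_nf
  have hg := (Real.Gamma_pos_of_pos hn1).le
  rw [e, add_mul, div_mul_eq_mul_div, ← mul_div_assoc]
  gcongr

theorem exists_norm_hankelIntegral_one_le {a : ℝ} (ha : 0 < a) :
    ∃ C, ∀ z, a ≤ z → ‖hankelIntegral 1 z‖ ≤ C * z ^ (-(1 / 2) : ℝ) := by
  obtain ⟨C, hC⟩ := exists_norm_integral_le 0 ha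
  refine ⟨C, fun z hz => ?_⟩
  have h := hC z hz (hankelIntegrand 1 z) fun s hs => by
    simpa using norm_hankelIntegrand_le 1 z hs
  simpa [hankelIntegral] using h

/-- The radiation condition for the Laplace integral: `(i - s)² - i (i - s) = -s (i - s)`, and the
factor `s` gains a power of `z`. -/
theorem exists_norm_hankelIntegral_radiation_le {a : ℝ} (ha : 0 < a) :
    ∃ C, ∀ z, a ≤ z → ‖hankelIntegral 2 z - Complex.I * hankelIntegral 1 z‖
      ≤ C * z ^ (-(3 / 2) : ℝ) := by
  obtain ⟨C, hC⟩ := exists_norm_integral_le 1 ha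
  refine ⟨C, fun z hz => ?_⟩
  have hz0 : 0 < z := ha.trans_le hz
  have h := hC z hz (fun s => hankelIntegrand 2 z s - Complex.I * hankelIntegrand 1 z s)
    fun s hs => by
      have e : hankelIntegrand 2 z s - Complex.I * hankelIntegrand 1 z s
          = -s * hankelIntegrand 1 z s := by
        simp only [hankelIntegrand]; ring
      rw [e, norm_mul, norm_neg, Complex.norm_real, Real.norm_eq_abs, abs_of_pos hs, pow_one]
      have := norm_hankelIntegrand_le 1 z hs
      rw [pow_one] at this
      gcongr
  rw [integral_sub (integrableOn_hankelIntegrand 2 hz0)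
    ((integrableOn_hankelIntegrand 1 hz0).const_mul _), integral_const_mul] at h
  rw [show (-(3 / 2) : ℝ) = -(((1 : ℕ) : ℝ) + 1 / 2) by norm_num]
  exact h

/-! ### The Laplace integral near the origin -/

/-- A primitive of `laplaceWeight`. -/
noncomputable def laplacePrimitive (s : ℝ) : ℂ := 2 * Complex.log ((√s : ℂ) + rootShift s)

/-- The part of `laplacePrimitive s` that remains after subtracting `log s`. -/
noncomputable def laplaceRemainder (s : ℝ) : ℂ := 2 * Complex.log (1 + rootShift s / (√s : ℂ))

theorem norm_clog_le {w : ℂ} (hw : 1 ≤ ‖w‖) : ‖Complex.log w‖ ≤ ‖w‖ + 3 := by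
  have h1 := Complex.norm_le_abs_re_add_abs_im (Complex.log w)
  rw [Complex.log_re, Complex.log_im, abs_of_nonneg (Real.log_nonneg hw)] at h1
  have h2 := Real.log_le_sub_one_of_pos (one_pos.trans_le hw)
  have h3 := Complex.abs_arg_le_pi w
  have h4 := Real.pi_lt_four
  linarith

theorem sqrt_add_rootShift_mem_slitPlane (s : ℝ) : (√s : ℂ) + rootShift s ∈ Complex.slitPlane := by
  left
  have h1 := rootShift_re_pos s
  have h2 := Real.sqrt_nonneg s
  simp only [Complex.add_re, Complex.ofReal_re]
  linarith

theorem continuous_laplacePrimitive : Continuous laplacePrimitive :=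
  continuous_const.mul (((Complex.continuous_ofReal.comp Real.continuous_sqrt).add
    continuous_rootShift).clog sqrt_add_rootShift_mem_slitPlane)

theorem hasDerivAt_laplacePrimitive {s : ℝ} (hs : 0 < s) :
    HasDerivAt laplacePrimitive (laplaceWeight s) s := by
  have h2 : HasDerivAt (fun s : ℝ => (√s : ℂ)) ((1 / (2 * √s) : ℝ) : ℂ) s :=
    (Real.hasDerivAt_sqrt hs.ne').ofReal_comp
  have h := ((h2.add (hasDerivAt_rootShift s)).clog_real
    (sqrt_add_rootShift_mem_slitPlane s)).const_mul 2
  refine h.congr_deriv ?_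
  have hq0 : (√s : ℂ) ≠ 0 := by exact_mod_cast (Real.sqrt_pos.2 hs).ne'
  have hr0 := rootShift_ne_zero s
  have hsum := Complex.slitPlane_ne_zero (sqrt_add_rootShift_mem_slitPlane s)
  rw [laplaceWeight]
  push_cast
  simp only [Pi.add_apply]
  field_simp
  ring

theorem norm_laplacePrimitive_le {s : ℝ} (hs : 0 ≤ s) : ‖laplacePrimitive s‖ ≤ 12 + 2 * s := by
  have hq := Real.sqrt_nonneg s
  have hq2 := Real.sq_sqrt hs
  have h1 : 1 ≤ ‖(√s : ℂ) + rootShift s‖ := by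
    have hr := rootShift_re_pos s
    have h := one_le_norm_rootShift s
    refine h.trans ?_
    rw [← sq_le_sq₀ (norm_nonneg _) (norm_nonneg _), Complex.sq_norm, Complex.sq_norm,
      Complex.normSq_apply, Complex.normSq_apply]
    simp only [Complex.add_re, Complex.ofReal_re, Complex.add_im, Complex.ofReal_im, zero_add]
    nlinarith [mul_nonneg hq hr.le]
  have h2 := norm_clog_le h1
  have h3 := norm_add_le (√s : ℂ) (rootShift s)
  rw [Complex.norm_real, Real.norm_eq_abs, abs_of_nonneg hq] at h3
  have h4 := norm_rootShift_le hs
  rw [laplacePrimitive, norm_mul, Complex.norm_ofNat]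
  nlinarith [sq_nonneg (√s - 1)]

theorem rootShift_div_sqrt_re_pos {s : ℝ} (hs : 0 < s) : 0 < (rootShift s / (√s : ℂ)).re := by
  rw [Complex.div_ofReal_re]
  exact div_pos (rootShift_re_pos s) (Real.sqrt_pos.2 hs)

theorem one_le_norm_one_add {w : ℂ} (hw : 0 < w.re) : 1 ≤ ‖1 + w‖ := by
  have h := (le_abs_self _).trans (Complex.abs_re_le_norm (1 + w))
  simp only [Complex.add_re, Complex.one_re] at h
  linarith

theorem laplacePrimitive_eq {s : ℝ} (hs : 0 < s) :
    laplacePrimitive s = (Real.log s : ℂ) + laplaceRemainder s := by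
  have hq := Real.sqrt_pos.2 hs
  have hq0 : (√s : ℂ) ≠ 0 := by exact_mod_cast hq.ne'
  have h1 : 1 + rootShift s / (√s : ℂ) ≠ 0 := by
    intro h
    have := one_le_norm_one_add (rootShift_div_sqrt_re_pos hs)
    rw [h, norm_zero] at this
    linarith
  have h2 : (√s : ℂ) + rootShift s = √s * (1 + rootShift s / (√s : ℂ)) := by field_simp
  rw [laplacePrimitive, laplaceRemainder, h2, Complex.log_ofReal_mul hq h1, Real.log_sqrt hs.le]
  push_cast; ring

theorem norm_laplaceRemainder_le {s : ℝ} (hs : 0 < s) :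
    ‖laplaceRemainder s‖ ≤ 10 + 4 * s ^ (1 / 2 - 1 : ℝ) := by
  have hq := Real.sqrt_pos.2 hs
  have h2 : s ^ (1 / 2 - 1 : ℝ) = 1 / √s := by
    rw [Real.sqrt_eq_rpow, one_div (s ^ _), ← Real.rpow_neg hs.le]; norm_num
  have h3 := norm_clog_le (one_le_norm_one_add (rootShift_div_sqrt_re_pos hs))
  have h4 := norm_add_le 1 (rootShift s / (√s : ℂ))
  have h5 : ‖rootShift s / (√s : ℂ)‖ ≤ 1 + 2 * (1 / √s) := by
    rw [norm_div, Complex.norm_real, Real.norm_eq_abs, abs_of_pos hq, div_le_iff₀ hq]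
    refine (norm_rootShift_le hs.le).trans_eq ?_
    field_simp
  rw [norm_one] at h4
  rw [h2, laplaceRemainder, norm_mul, Complex.norm_ofNat]
  linarith

theorem tendsto_rootShift_div_sqrt :
    Tendsto (fun s : ℝ => rootShift s / (√s : ℂ)) atTop (𝓝 1) := by
  rw [tendsto_iff_norm_sub_tendsto_zero]
  refine squeeze_zero' (.of_forall fun _ => norm_nonneg _) ?_
    (tendsto_const_nhds.div_atTop tendsto_id : Tendsto (fun s : ℝ => 2 / s) atTop (𝓝 0))
  filter_upwards [eventually_gt_atTop 0] with s hs
  have hq0 : (√s : ℂ) ≠ 0 := by exact_mod_cast (Real.sqrt_pos.2 hs).ne'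
  have hq : (√s : ℂ) ^ 2 = s := by exact_mod_cast Real.sq_sqrt hs.le
  have hs0 : (s : ℂ) ≠ 0 := by exact_mod_cast hs.ne'
  have e : (rootShift s / (√s : ℂ) - 1) * (1 + rootShift s / (√s : ℂ))
      = -(2 * Complex.I) / s := by
    have : (rootShift s / (√s : ℂ)) ^ 2 = ((s : ℂ) - 2 * Complex.I) / s := by
      rw [div_pow, hq, rootShift_sq]
    rw [sub_div, div_self hs0] at this
    linear_combination this
  have h1 := one_le_norm_one_add (rootShift_div_sqrt_re_pos hs)
  have h2 := congrArg norm e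
  rw [norm_mul, norm_div, norm_neg, norm_mul, Complex.norm_I, Complex.norm_real,
    Real.norm_eq_abs, abs_of_pos hs, Complex.norm_ofNat, mul_one] at h2
  rw [← h2]
  exact le_mul_of_one_le_right (norm_nonneg _) h1

theorem tendsto_laplaceRemainder : Tendsto laplaceRemainder atTop (𝓝 (2 * Complex.log 2)) := by
  have h := tendsto_rootShift_div_sqrt.const_add 1
  rw [one_add_one_eq_two] at h
  exact (h.clog (Or.inl (by norm_num))).const_mul 2

theorem continuousOn_laplaceRemainder : ContinuousOn laplaceRemainder (Ioi 0) := by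
  refine continuousOn_const.mul (ContinuousOn.clog ?_ ?_)
  · refine continuousOn_const.add (continuous_rootShift.continuousOn.div ?_ ?_)
    · exact (Complex.continuous_ofReal.comp Real.continuous_sqrt).continuousOn
    · exact fun s hs => by exact_mod_cast (Real.sqrt_pos.2 hs).ne'
  · intro s hs
    left
    have := rootShift_div_sqrt_re_pos hs
    simp only [Complex.add_re, Complex.one_re]
    linarith

theorem laplacePrimitive_zero : laplacePrimitive 0 = Real.log 2 - Real.pi / 2 * Complex.I := by
  have h1 : Complex.log ((0 : ℝ) - 2 * Complex.I) = Real.log 2 - Real.pi / 2 * Complex.I := by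
    have h : ((0 : ℝ) : ℂ) - 2 * Complex.I = ((2 : ℝ) : ℂ) * -Complex.I := by push_cast; ring
    rw [h, Complex.log_ofReal_mul two_pos (neg_ne_zero.2 Complex.I_ne_zero), Complex.log_neg_I]
    ring
  have hpi := Real.pi_pos
  have him : ((Real.log 2 - Real.pi / 2 * Complex.I : ℂ) / 2).im = -(Real.pi / 4) := by
    rw [Complex.div_ofNat_im, Complex.sub_im, Complex.ofReal_im, Complex.mul_I_im]
    simp
    ring
  rw [laplacePrimitive, rootShift_eq_exp, Real.sqrt_zero, Complex.ofReal_zero, zero_add]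
  rw [Complex.ofReal_zero] at h1
  rw [h1, Complex.log_exp (by rw [him]; linarith) (by rw [him]; linarith)]
  ring

theorem integrableOn_affine_mul_exp (A B : ℝ) {r : ℝ} (hr : 0 < r) :
    IntegrableOn (fun s : ℝ => (A + B * s) * Real.exp (-(r * s))) (Ioi 0) := by
  have h1 := (integrableOn_rpow_mul_exp one_pos hr).const_mul A
  have h2 := (integrableOn_rpow_mul_exp two_pos hr).const_mul B
  refine (h1.add h2).congr ?_
  refine (ae_restrict_iff' measurableSet_Ioi).2 (ae_of_all _ fun s _ => ?_)
  simp only [Pi.add_apply]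
  norm_num
  ring

theorem integrableOn_exp_mul_laplacePrimitive {r : ℝ} (hr : 0 < r) :
    IntegrableOn (fun s : ℝ => (Real.exp (-(r * s)) : ℂ) * laplacePrimitive s) (Ioi 0) := by
  refine Integrable.mono' (integrableOn_affine_mul_exp 12 2 hr) ?_ ?_
  · have := continuous_laplacePrimitive
    exact Continuous.aestronglyMeasurable (by fun_prop)
  · refine (ae_restrict_iff' measurableSet_Ioi).2 (ae_of_all _ fun s hs => ?_)
    rw [norm_mul, Complex.norm_real, Real.norm_eq_abs, Real.abs_exp, mul_comm]
    gcongr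
    exact norm_laplacePrimitive_le (le_of_lt hs)

theorem continuousOn_laplaceRemainder_div {z : ℝ} (hz : 0 < z) :
    ContinuousOn (fun v : ℝ => (Real.exp (-v) : ℂ) * laplaceRemainder (v / z)) (Ioi 0) := by
  refine ContinuousOn.mul (by fun_prop) (continuousOn_laplaceRemainder.comp (by fun_prop) ?_)
  exact fun v hv => div_pos hv hz

theorem norm_exp_mul_laplaceRemainder_le {z v : ℝ} (hz : 0 < z) (hz1 : z ≤ 1) (hv : 0 < v) :
    ‖(Real.exp (-v) : ℂ) * laplaceRemainder (v / z)‖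
      ≤ 10 * Real.exp (-v) + 4 * (v ^ (1 / 2 - 1 : ℝ) * Real.exp (-v)) := by
  have h1 := norm_laplaceRemainder_le (div_pos hv hz)
  have h2 : (v / z) ^ (1 / 2 - 1 : ℝ) ≤ v ^ (1 / 2 - 1 : ℝ) :=
    Real.rpow_le_rpow_of_nonpos hv ((le_div_iff₀ hz).2 (by nlinarith)) (by norm_num)
  rw [norm_mul, Complex.norm_real, Real.norm_eq_abs, Real.abs_exp]
  have := Real.exp_pos (-v)
  nlinarith

theorem integrableOn_remainderBound :
    IntegrableOn (fun v : ℝ => 10 * Real.exp (-v) + 4 * (v ^ (1 / 2 - 1 : ℝ) * Real.exp (-v)))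
      (Ioi 0) := by
  have h := (integrableOn_rpow_mul_exp (a := 1 / 2) (by norm_num) one_pos).const_mul 4
  simp only [one_mul] at h
  exact ((integrableOn_exp_neg_Ioi 0).const_mul 10).add h

theorem integrableOn_exp_mul_laplaceRemainder {z : ℝ} (hz : 0 < z) (hz1 : z ≤ 1) :
    IntegrableOn (fun v : ℝ => (Real.exp (-v) : ℂ) * laplaceRemainder (v / z)) (Ioi 0) :=
  Integrable.mono' integrableOn_remainderBound
    ((continuousOn_laplaceRemainder_div hz).aestronglyMeasurable measurableSet_Ioi)
    ((ae_restrict_iff' measurableSet_Ioi).2 (ae_of_all _ fun _ hv =>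
      norm_exp_mul_laplaceRemainder_le hz hz1 hv))

theorem tendsto_const_div_nhdsGT_zero {v : ℝ} (hv : 0 < v) :
    Tendsto (fun z : ℝ => v / z) (𝓝[>] 0) atTop := by
  simpa [div_eq_mul_inv] using tendsto_inv_nhdsGT_zero.const_mul_atTop hv

theorem integral_exp_neg_complex : ∫ v in Ioi (0 : ℝ), (Real.exp (-v) : ℂ) = 1 := by
  rw [integral_complex_ofReal, integral_exp_neg_Ioi_zero, Complex.ofReal_one]

theorem tendsto_integral_laplaceRemainder :
    Tendsto (fun z : ℝ => ∫ v in Ioi (0 : ℝ), (Real.exp (-v) : ℂ) * laplaceRemainder (v / z))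
      (𝓝[>] 0) (𝓝 (2 * Complex.log 2)) := by
  have e : ∫ v in Ioi (0 : ℝ), (Real.exp (-v) : ℂ) * (2 * Complex.log 2) = 2 * Complex.log 2 := by
    rw [integral_mul_const, integral_exp_neg_complex, one_mul]
  rw [← e]
  refine tendsto_integral_filter_of_dominated_convergence _ ?_ ?_ integrableOn_remainderBound ?_
  · filter_upwards [self_mem_nhdsWithin] with z hz
    exact (continuousOn_laplaceRemainder_div hz).aestronglyMeasurable measurableSet_Ioi
  · filter_upwards [Ioc_mem_nhdsGT one_pos] with z hz
    exact (ae_restrict_iff' measurableSet_Ioi).2 (ae_of_all _ fun _ hv =>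
      norm_exp_mul_laplaceRemainder_le hz.1 hz.2 hv)
  · refine (ae_restrict_iff' measurableSet_Ioi).2 (ae_of_all _ fun v hv => ?_)
    exact (tendsto_laplaceRemainder.comp (tendsto_const_div_nhdsGT_zero hv)).const_mul _

theorem integrableOn_exp_mul_log :
    IntegrableOn (fun v : ℝ => (Real.exp (-v) : ℂ) * (Real.log v : ℂ)) (Ioi 0) := by
  have h1 := integrableOn_exp_mul_laplacePrimitive one_pos
  have h2 := integrableOn_exp_mul_laplaceRemainder one_pos le_rfl
  refine (h1.sub h2).congr ?_
  refine (ae_restrict_iff' measurableSet_Ioi).2 (ae_of_all _ fun s hs => ?_)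
  simp only [Pi.sub_apply, one_mul, div_one]
  rw [laplacePrimitive_eq hs]
  ring

/-- `∫₀^∞ e^{-v} log v dv = Γ'(1) = -γ`. -/
theorem integral_exp_mul_log :
    ∫ v in Ioi (0 : ℝ), (Real.exp (-v) : ℂ) * (Real.log v : ℂ)
      = -Real.eulerMascheroniConstant := by
  have h1 := Complex.hasDerivAt_GammaIntegral (s := 1) (by simp)
  have h2 : HasDerivAt Complex.GammaIntegral (-Real.eulerMascheroniConstant) 1 := by
    refine Complex.hasDerivAt_Gamma_one.congr_of_eventuallyEq ?_
    have : {s : ℂ | 0 < s.re} ∈ 𝓝 (1 : ℂ) :=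
      (isOpen_lt continuous_const Complex.continuous_re).mem_nhds (by simp)
    filter_upwards [this] with s hs
    exact (Complex.Gamma_eq_integral hs).symm
  rw [← h1.unique h2]
  refine setIntegral_congr_fun measurableSet_Ioi fun v hv => ?_
  simp [mul_comm]

theorem hankelIntegrand_zero_eq (z s : ℝ) : hankelIntegrand 0 z s
    = Complex.exp (z * Complex.I) * ((Real.exp (-(z * s)) : ℂ) * laplaceWeight s) := by
  rw [hankelIntegrand, pow_zero, one_mul, mul_sub, sub_eq_add_neg, Complex.exp_add]
  push_cast
  ring

theorem integrableOn_exp_mul_laplaceWeight {z : ℝ} (hz : 0 < z) :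
    IntegrableOn (fun s : ℝ => (Real.exp (-(z * s)) : ℂ) * laplaceWeight s) (Ioi 0) := by
  refine ((integrableOn_hankelIntegrand 0 hz).const_mul (Complex.exp (-(z * Complex.I)))).congr ?_
  refine ae_of_all _ fun s => ?_
  simp only
  rw [hankelIntegrand_zero_eq, ← mul_assoc, ← Complex.exp_add]
  simp

/-- The rescaling `v = z s` of a Laplace integral. -/
theorem integral_exp_rescale (f : ℝ → ℂ) {z : ℝ} (hz : 0 < z) :
    z * ∫ s in Ioi (0 : ℝ), (Real.exp (-(z * s)) : ℂ) * f s
      = ∫ v in Ioi (0 : ℝ), (Real.exp (-v) : ℂ) * f (v / z) := by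
  have h := integral_comp_mul_left_Ioi (fun v : ℝ => (Real.exp (-v) : ℂ) * f (v / z)) 0 hz
  simp only [mul_zero, mul_div_cancel_left₀ _ hz.ne'] at h
  rw [h, Complex.real_smul, Complex.ofReal_inv, mul_inv_cancel_left₀ (by exact_mod_cast hz.ne')]

/-- Integration by parts isolates the logarithmic singularity of the Laplace integral. -/
theorem integral_exp_mul_laplaceWeight {z : ℝ} (hz : 0 < z) (hz1 : z ≤ 1) :
    ∫ s in Ioi (0 : ℝ), (Real.exp (-(z * s)) : ℂ) * laplaceWeight s
      = -laplacePrimitive 0 - Real.eulerMascheroniConstant - Real.log z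
        + ∫ v in Ioi (0 : ℝ), (Real.exp (-v) : ℂ) * laplaceRemainder (v / z) := by
  have hu : ∀ s ∈ Ioi (0 : ℝ), HasDerivAt (fun s : ℝ => (Real.exp (-(z * s)) : ℂ))
      (-z * (Real.exp (-(z * s)) : ℂ)) s := fun s _ => by
    have h := ((((hasDerivAt_id s).const_mul z).neg).exp).ofReal_comp
    refine h.congr_deriv ?_
    simp only [id, Pi.neg_apply]; push_cast; ring
  have hprim := integrableOn_exp_mul_laplacePrimitive hz
  have hint : IntegrableOn ((fun s : ℝ => -z * (Real.exp (-(z * s)) : ℂ)) * laplacePrimitive)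
      (Ioi 0) := by
    refine (hprim.const_mul (-z : ℂ)).congr (ae_of_all _ fun s => ?_)
    simp only [Pi.mul_apply]; ring
  have hcont := continuous_laplacePrimitive
  have h0 : Tendsto ((fun s : ℝ => (Real.exp (-(z * s)) : ℂ)) * laplacePrimitive) (𝓝[>] 0)
      (𝓝 (laplacePrimitive 0)) := by
    have hc : Continuous ((fun s : ℝ => (Real.exp (-(z * s)) : ℂ)) * laplacePrimitive) :=
      Continuous.mul (by fun_prop) hcont
    have h := hc.tendsto 0
    simp only [Pi.mul_apply, mul_zero, neg_zero, Real.exp_zero, Complex.ofReal_one, one_mul] at h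
    exact h.mono_left nhdsWithin_le_nhds
  have hinf : Tendsto ((fun s : ℝ => (Real.exp (-(z * s)) : ℂ)) * laplacePrimitive) atTop
      (𝓝 0) := by
    refine squeeze_zero_norm' ?_ (tendsto_affine_mul_exp_neg 12 2 hz)
    filter_upwards [eventually_ge_atTop 0] with s hs
    rw [Pi.mul_apply, norm_mul, Complex.norm_real, Real.norm_eq_abs, Real.abs_exp, mul_comm]
    gcongr
    exact norm_laplacePrimitive_le hs
  have h := integral_Ioi_mul_deriv_eq_deriv_mul hu (fun s hs => hasDerivAt_laplacePrimitive hs)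
    (integrableOn_exp_mul_laplaceWeight hz) hint h0 hinf
  have e1 : ∫ s in Ioi (0 : ℝ), (-z * (Real.exp (-(z * s)) : ℂ)) * laplacePrimitive s
      = -∫ v in Ioi (0 : ℝ), (Real.exp (-v) : ℂ) * laplacePrimitive (v / z) := by
    rw [← integral_exp_rescale _ hz, ← neg_mul, ← integral_const_mul]
    simp only [mul_assoc]
  have i1 := integrableOn_exp_mul_log
  have i2 : IntegrableOn (fun v : ℝ => (Real.exp (-v) : ℂ)) (Ioi 0) :=
    (integrableOn_exp_neg_Ioi 0).ofReal
  have i3 := integrableOn_exp_mul_laplaceRemainder hz hz1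
  have e2 : ∫ v in Ioi (0 : ℝ), (Real.exp (-v) : ℂ) * laplacePrimitive (v / z)
      = ∫ v in Ioi (0 : ℝ), ((Real.exp (-v) : ℂ) * (Real.log v : ℂ)
        - (Real.exp (-v) : ℂ) * (Real.log z : ℂ)
        + (Real.exp (-v) : ℂ) * laplaceRemainder (v / z)) := by
    refine setIntegral_congr_fun measurableSet_Ioi fun v hv => ?_
    have hv : 0 < v := hv
    rw [laplacePrimitive_eq (div_pos hv hz), Real.log_div hv.ne' hz.ne']
    push_cast
    ring
  have i4 : IntegrableOn (fun v : ℝ => (Real.exp (-v) : ℂ) * (Real.log v : ℂ)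
      - (Real.exp (-v) : ℂ) * (Real.log z : ℂ)) (Ioi 0) := i1.sub (i2.mul_const _)
  rw [integral_add i4 i3, integral_sub i1 (i2.mul_const _), integral_exp_mul_log,
    integral_mul_const, integral_exp_neg_complex] at e2
  rw [h, e1, e2]
  ring

theorem hankelIntegral_zero_eq (z : ℝ) : hankelIntegral 0 z = Complex.exp (z * Complex.I)
    * ∫ s in Ioi (0 : ℝ), (Real.exp (-(z * s)) : ℂ) * laplaceWeight s := by
  rw [hankelIntegral, ← integral_const_mul]
  exact integral_congr_ae (ae_of_all _ fun s => hankelIntegrand_zero_eq z s)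

theorem tendsto_integral_add_log :
    Tendsto (fun z : ℝ => (∫ s in Ioi (0 : ℝ), (Real.exp (-(z * s)) : ℂ) * laplaceWeight s)
      + (Real.log (z / 2) + Real.eulerMascheroniConstant : ℝ)) (𝓝[>] 0)
      (𝓝 (Real.pi / 2 * Complex.I)) := by
  have h := tendsto_integral_laplaceRemainder.const_add (-laplacePrimitive 0 - Real.log 2)
  have e : -laplacePrimitive 0 - Real.log 2 + 2 * Complex.log 2 = Real.pi / 2 * Complex.I := by
    have : Complex.log 2 = (Real.log 2 : ℝ) := by
      rw [Complex.ofReal_log zero_le_two]; norm_num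
    rw [laplacePrimitive_zero, this]; ring
  rw [e] at h
  refine h.congr' ?_
  filter_upwards [Ioc_mem_nhdsGT one_pos] with z hz
  rw [integral_exp_mul_laplaceWeight hz.1 hz.2, Real.log_div hz.1.ne' two_ne_zero]
  push_cast
  ring

theorem tendsto_ofReal_nhdsGT_zero : Tendsto (fun z : ℝ => (z : ℂ)) (𝓝[>] 0) (𝓝 0) := by
  have h := Complex.continuous_ofReal.tendsto 0
  rw [Complex.ofReal_zero] at h
  exact h.mono_left nhdsWithin_le_nhds

theorem tendsto_mul_integral_exp_mul_laplaceWeight :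
    Tendsto (fun z : ℝ => z * ∫ s in Ioi (0 : ℝ), (Real.exp (-(z * s)) : ℂ) * laplaceWeight s)
      (𝓝[>] 0) (𝓝 0) := by
  have h1 := tendsto_ofReal_nhdsGT_zero.mul tendsto_integral_add_log
  have h2 := (Complex.continuous_ofReal.tendsto 0).comp
    (tendsto_log_half_mul_self Real.eulerMascheroniConstant)
  rw [Complex.ofReal_zero] at h2
  have h := h1.sub h2
  rw [zero_mul, sub_zero] at h
  refine h.congr fun z => ?_
  simp only [Function.comp_apply]
  push_cast
  ring

theorem tendsto_exp_sub_one_div :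
    Tendsto (fun z : ℝ => (Complex.exp (z * Complex.I) - 1) / z) (𝓝[>] 0) (𝓝 Complex.I) := by
  have h : HasDerivAt (fun z : ℝ => Complex.exp (z * Complex.I)) Complex.I 0 := by
    have := ((Complex.ofRealCLM.hasDerivAt (x := 0)).mul_const Complex.I).cexp
    simpa using this
  have := h.tendsto_slope_zero_right
  refine this.congr fun z => ?_
  simp [div_eq_inv_mul]

/-- The logarithmic behaviour of the Laplace integral at the origin. -/
theorem tendsto_hankelIntegral_zero_add_log :
    Tendsto (fun z : ℝ => hankelIntegral 0 z
      + (Real.log (z / 2) + Real.eulerMascheroniConstant : ℝ)) (𝓝[>] 0)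
      (𝓝 (Real.pi / 2 * Complex.I)) := by
  have h := (tendsto_exp_sub_one_div.mul tendsto_mul_integral_exp_mul_laplaceWeight).add
    tendsto_integral_add_log
  rw [mul_zero, zero_add] at h
  refine h.congr' ?_
  filter_upwards [self_mem_nhdsWithin] with z hz
  have : (z : ℂ) ≠ 0 := by exact_mod_cast ne_of_gt hz
  rw [hankelIntegral_zero_eq]
  field_simp
  ring

theorem tendsto_integral_mul_laplaceWeight :
    Tendsto (fun z : ℝ => ∫ v in Ioi (0 : ℝ),
      (Real.exp (-v) : ℂ) * (((v / z : ℝ) : ℂ) * laplaceWeight (v / z))) (𝓝[>] 0) (𝓝 1) := by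
  have hw : ∀ s : ℝ, 0 < s → (s : ℂ) * laplaceWeight s = (rootShift s / (√s : ℂ))⁻¹ := by
    intro s hs
    have hq0 : (√s : ℂ) ≠ 0 := by exact_mod_cast (Real.sqrt_pos.2 hs).ne'
    have hq : (√s : ℂ) ^ 2 = s := by exact_mod_cast Real.sq_sqrt hs.le
    have hr0 := rootShift_ne_zero s
    rw [laplaceWeight, ← hq]
    field_simp
  rw [← integral_exp_neg_complex]
  refine tendsto_integral_filter_of_dominated_convergence (fun v => Real.exp (-v)) ?_ ?_
    (integrableOn_exp_neg_Ioi 0) ?_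
  · filter_upwards [self_mem_nhdsWithin] with z hz
    refine ContinuousOn.aestronglyMeasurable ?_ measurableSet_Ioi
    refine ContinuousOn.mul (by fun_prop) (ContinuousOn.mul (by fun_prop)
      (continuousOn_laplaceWeight.comp (by fun_prop) ?_))
    exact fun v hv => mem_Ioi.2 (div_pos (mem_Ioi.1 hv) (mem_Ioi.1 hz))
  · filter_upwards [self_mem_nhdsWithin] with z hz
    refine (ae_restrict_iff' measurableSet_Ioi).2 (ae_of_all _ fun v hv => ?_)
    have hs : 0 < v / z := div_pos hv hz
    rw [hw _ hs, norm_mul, Complex.norm_real, Real.norm_eq_abs, Real.abs_exp, norm_inv, norm_div,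
      Complex.norm_real, Real.norm_eq_abs, abs_of_pos (Real.sqrt_pos.2 hs)]
    refine mul_le_of_le_one_right (Real.exp_pos _).le (inv_le_one_of_one_le₀ ?_)
    rw [one_le_div (Real.sqrt_pos.2 hs)]
    exact sqrt_le_norm_rootShift _
  · refine (ae_restrict_iff' measurableSet_Ioi).2 (ae_of_all _ fun v hv => ?_)
    have h := (tendsto_rootShift_div_sqrt.inv₀ one_ne_zero).comp (tendsto_const_div_nhdsGT_zero hv)
    rw [inv_one] at h
    have h' := h.const_mul (Real.exp (-v) : ℂ)
    rw [mul_one] at h'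
    refine h'.congr' ?_
    filter_upwards [self_mem_nhdsWithin] with z hz
    rw [hw _ (div_pos (mem_Ioi.1 hv) (mem_Ioi.1 hz))]
    rfl

theorem tendsto_mul_hankelIntegral_one :
    Tendsto (fun z : ℝ => z * hankelIntegral 1 z) (𝓝[>] 0) (𝓝 (-1)) := by
  have hexp : Tendsto (fun z : ℝ => Complex.exp (z * Complex.I)) (𝓝[>] 0) (𝓝 1) := by
    have h : Continuous fun z : ℝ => Complex.exp (z * Complex.I) := by fun_prop
    have h := h.tendsto 0
    simp only [Complex.ofReal_zero, zero_mul, Complex.exp_zero] at h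
    exact h.mono_left nhdsWithin_le_nhds
  have h := hexp.mul ((tendsto_mul_integral_exp_mul_laplaceWeight.const_mul Complex.I).sub
    tendsto_integral_mul_laplaceWeight)
  rw [mul_zero, zero_sub, one_mul] at h
  refine h.congr' ?_
  filter_upwards [self_mem_nhdsWithin] with z hz
  have hz : 0 < z := hz
  have i0 := (integrableOn_exp_mul_laplaceWeight hz).const_mul Complex.I
  have hE : Complex.exp (z * Complex.I) ≠ 0 := Complex.exp_ne_zero _
  have e : ∀ s : ℝ, hankelIntegrand 1 z s = Complex.exp (z * Complex.I)
      * (Complex.I * ((Real.exp (-(z * s)) : ℂ) * laplaceWeight s)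
        - (Real.exp (-(z * s)) : ℂ) * ((s : ℂ) * laplaceWeight s)) := by
    intro s
    have h0 := hankelIntegrand_zero_eq z s
    simp only [hankelIntegrand, pow_zero, one_mul, pow_one] at h0 ⊢
    rw [mul_assoc, h0]
    ring
  have i1 : IntegrableOn (fun s : ℝ => (Real.exp (-(z * s)) : ℂ) * ((s : ℂ) * laplaceWeight s))
      (Ioi 0) := by
    have h1 := i0.sub ((integrableOn_hankelIntegrand 1 hz).const_mul
      (Complex.exp (z * Complex.I))⁻¹)
    refine h1.congr (ae_of_all _ fun s => ?_)
    simp only [Pi.sub_apply, e, inv_mul_cancel_left₀ hE]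
    ring
  rw [hankelIntegral, integral_congr_ae (ae_of_all _ e), integral_const_mul, integral_sub i0 i1,
    integral_const_mul, ← integral_exp_rescale (fun s => (s : ℂ) * laplaceWeight s) hz]
  ring

/-! ### Identification of the Laplace integral with the Hankel function -/

/-- A solution of Bessel's equation with `f → 0` and `t f' → 0` at the origin vanishes: integrating
`(t f')' = -t f` gives `f' → 0`, and `|f|² + |f'|²` is non-increasing. -/
theorem bessel_solution_eq_zero {f f' : ℝ → ℂ} (hf : ∀ t, 0 < t → HasDerivAt f (f' t) t)
    (hf' : ∀ t, 0 < t → HasDerivAt f' (-f t - f' t / t) t)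
    (h0 : Tendsto f (𝓝[>] 0) (𝓝 0)) (h1 : Tendsto (fun t : ℝ => t * f' t) (𝓝[>] 0) (𝓝 0)) :
    ∀ t, 0 < t → f t = 0 := by
  have hP : ∀ t : ℝ, 0 < t → HasDerivAt (fun t : ℝ => t * f' t) (-(t * f t)) t := by
    intro t ht
    refine ((Complex.ofRealCLM.hasDerivAt (x := t)).mul (hf' t ht)).congr_deriv ?_
    have : (t : ℂ) ≠ 0 := by exact_mod_cast ht.ne'
    simp
    field_simp
    ring
  have hsmall : ∀ᶠ t in 𝓝[>] (0 : ℝ), ‖f t‖ ≤ 1 := by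
    have := h0.norm
    rw [norm_zero] at this
    exact this.eventually (ge_mem_nhds one_pos)
  obtain ⟨δ, hδ, hδf⟩ := mem_nhdsGT_iff_exists_Ioo_subset.1 hsmall
  have hδ : 0 < δ := hδ
  have hf'bound : ∀ t ∈ Ioo 0 δ, ‖f' t‖ ≤ t := by
    intro t ht
    have ht0 : 0 < t := ht.1
    have hle : ∀ ε ∈ Ioo 0 t, ‖(t : ℂ) * f' t - ε * f' ε‖ ≤ t * t := by
      intro ε hε
      have h := (convex_Icc ε t).norm_image_sub_le_of_norm_hasDerivWithin_le
        (f := fun t : ℝ => t * f' t) (f' := fun t => -(t * f t)) (C := t)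
        (fun x hx => (hP x (hε.1.trans_le hx.1)).hasDerivWithinAt)
        (fun x hx => by
          have hx0 : 0 < x := hε.1.trans_le hx.1
          have hfx : ‖f x‖ ≤ 1 := hδf ⟨hx0, hx.2.trans_lt ht.2⟩
          rw [norm_neg, norm_mul, Complex.norm_real, Real.norm_eq_abs, abs_of_pos hx0]
          nlinarith [hx.2, norm_nonneg (f x)])
        (left_mem_Icc.2 hε.2.le) (right_mem_Icc.2 hε.2.le)
      refine h.trans ?_
      rw [Real.norm_eq_abs, abs_of_pos (sub_pos.2 hε.2)]
      gcongr
      linarith [hε.1]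
    have hlim : Tendsto (fun ε : ℝ => ‖(t : ℂ) * f' t - ε * f' ε‖) (𝓝[>] 0)
        (𝓝 ‖(t : ℂ) * f' t - 0‖) := (h1.const_sub _).norm
    have h := le_of_tendsto hlim (by
      filter_upwards [Ioo_mem_nhdsGT ht0] with ε hε using hle ε hε)
    rw [sub_zero, norm_mul, Complex.norm_real, Real.norm_eq_abs, abs_of_pos ht0] at h
    exact le_of_mul_le_mul_left h ht0
  have hf'lim : Tendsto (fun t => ‖f' t‖) (𝓝[>] 0) (𝓝 0) := by
    refine squeeze_zero' (.of_forall fun _ => norm_nonneg _) ?_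
      (nhdsWithin_le_nhds : Tendsto (fun t : ℝ => t) (𝓝[>] 0) (𝓝 0))
    filter_upwards [Ioo_mem_nhdsGT hδ] with t ht using hf'bound t ht
  have hE : ∀ t, 0 < t → HasDerivAt (fun t => ‖f t‖ ^ 2 + ‖f' t‖ ^ 2)
      (-(2 / t * ‖f' t‖ ^ 2)) t := by
    intro t ht
    refine ((hf t ht).norm_sq.add (hf' t ht).norm_sq).congr_deriv ?_
    have e : -f t - f' t / t = -f t - (t⁻¹ : ℝ) • f' t := by
      rw [Complex.real_smul]; push_cast; ring
    rw [e, inner_sub_right, inner_neg_right, inner_smul_right, real_inner_self_eq_norm_sq,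
      real_inner_comm (f' t) (f t)]
    field_simp
    ring
  have hanti : AntitoneOn (fun t => ‖f t‖ ^ 2 + ‖f' t‖ ^ 2) (Ioi 0) := by
    refine antitoneOn_of_deriv_nonpos (convex_Ioi 0)
      (fun t ht => (hE t ht).continuousAt.continuousWithinAt) ?_ ?_
    · rw [interior_Ioi]
      exact fun t ht => (hE t ht).differentiableAt.differentiableWithinAt
    · rw [interior_Ioi]
      intro t ht
      have ht : 0 < t := ht
      rw [(hE t ht).deriv, neg_nonpos]
      positivity
  have hElim : Tendsto (fun t => ‖f t‖ ^ 2 + ‖f' t‖ ^ 2) (𝓝[>] 0) (𝓝 0) := by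
    simpa using (h0.norm.pow 2).add (hf'lim.pow 2)
  intro t ht
  have hle : ‖f t‖ ^ 2 + ‖f' t‖ ^ 2 ≤ 0 := by
    refine ge_of_tendsto hElim ?_
    filter_upwards [Ioo_mem_nhdsGT ht] with s hs using hanti hs.1 ht hs.2.le
  have : ‖f t‖ ^ 2 = 0 := le_antisymm (by nlinarith [sq_nonneg ‖f' t‖]) (sq_nonneg _)
  simpa using this

/-- The Laplace integral representation of the Hankel function. -/
theorem hankelZero_eq {t : ℝ} (ht : 0 < t) :
    hankelZero t = -(2 * Complex.I / Real.pi) * hankelIntegral 0 t := by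
  set J : ℝ → ℝ := fun t => powSeries besselCoeff (t ^ 2 / 4)
  set J' : ℝ → ℝ := fun t => t / 2 * powSeries (derivCoeff besselCoeff) (t ^ 2 / 4)
  have hJ : ∀ t, HasDerivAt J (J' t) t := factorialDecay_besselCoeff.hasDerivAt_comp
  have hJ' : ∀ t, 0 < t → HasDerivAt J' (-J t - J' t / t) t := fun t ht =>
    hasDerivAt_besselJZero_deriv ht
  -- the difference of the two sides, up to a factor, solves Bessel's equation and vanishes at `0`
  have key := bessel_solution_eq_zero
    (f := fun t => hankelIntegral 0 t - Real.pi / 2 * Complex.I * J t + neumannPart t)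
    (f' := fun t => hankelIntegral 1 t - Real.pi / 2 * Complex.I * J' t + neumannPartDeriv t)
    (fun t ht => ((hasDerivAt_hankelIntegral 0 ht).sub
      ((hJ t).ofReal_comp.const_mul _)).add (hasDerivAt_neumannPart ht).ofReal_comp)
    (fun t ht => by
      refine (((hasDerivAt_hankelIntegral 1 ht).sub
        ((hJ' t ht).ofReal_comp.const_mul (Real.pi / 2 * Complex.I : ℂ))).add
        (hasDerivAt_neumannPartDeriv ht).ofReal_comp).congr_deriv ?_
      have h := hankelIntegral_bessel ht
      have ht0 : (t : ℂ) ≠ 0 := by exact_mod_cast ht.ne'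
      push_cast
      field_simp
      linear_combination 2 * h)
    (by
      have hJ0 : Tendsto (fun t => (J t : ℂ)) (𝓝[>] 0) (𝓝 1) := by
        have h := (Complex.continuous_ofReal.tendsto _).comp
          factorialDecay_besselCoeff.tendsto_comp
        have e : besselCoeff 0 = 1 := by simp [besselCoeff]
        rw [e, Complex.ofReal_one] at h
        exact h
      have h2 := (Complex.continuous_ofReal.tendsto _).comp tendsto_neumannPart_sub_log
      have h := (tendsto_hankelIntegral_zero_add_log.sub
        (hJ0.const_mul (Real.pi / 2 * Complex.I : ℂ))).add h2
      rw [mul_one, sub_self, Complex.ofReal_zero, add_zero] at h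
      refine h.congr fun t => ?_
      simp only [Function.comp_apply]
      push_cast
      ring)
    (by
      have hJ0 : Tendsto (fun t : ℝ => (t : ℂ) * J' t) (𝓝[>] 0) (𝓝 0) := by
        have hc : ContinuousAt J' 0 :=
          (factorialDecay_besselCoeff.hasDerivAt_deriv_comp 0).continuousAt
        have h := tendsto_ofReal_nhdsGT_zero.mul
          ((Complex.continuous_ofReal.tendsto _).comp (hc.tendsto.mono_left nhdsWithin_le_nhds))
        rw [zero_mul] at h
        exact h
      have h2 := (Complex.continuous_ofReal.tendsto _).comp tendsto_mul_neumannPartDeriv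
      have h := (tendsto_mul_hankelIntegral_one.sub
        (hJ0.const_mul (Real.pi / 2 * Complex.I : ℂ))).add h2
      rw [mul_zero, sub_zero, Complex.ofReal_one, neg_add_cancel] at h
      refine h.congr fun t => ?_
      simp only [Function.comp_apply]
      push_cast
      ring) t ht
  have hpi : (Real.pi : ℂ) ≠ 0 := by exact_mod_cast Real.pi_ne_zero
  have hI : Complex.I ^ 2 = -1 := Complex.I_sq
  rw [hankelZero, besselJZero_eq, besselYZero_eq]
  simp only [J] at key
  push_cast
  field_simp
  linear_combination 2 * Complex.I * key
    + Real.pi * (powSeries besselCoeff (t ^ 2 / 4) : ℂ) * hI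

/-- The derivatives of `H₀⁽¹⁾` on the positive half-line. -/
noncomputable def hankelDeriv (n : ℕ) (t : ℝ) : ℂ := -(2 * Complex.I / Real.pi) * hankelIntegral n t

theorem hasDerivAt_hankelDeriv (n : ℕ) {t : ℝ} (ht : 0 < t) :
    HasDerivAt (hankelDeriv n) (hankelDeriv (n + 1) t) t :=
  (hasDerivAt_hankelIntegral n ht).const_mul _

theorem hasDerivAt_hankelZero {t : ℝ} (ht : 0 < t) :
    HasDerivAt hankelZero (hankelDeriv 1 t) t := by
  refine (hasDerivAt_hankelDeriv 0 ht).congr_of_eventuallyEq ?_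
  filter_upwards [Ioi_mem_nhds ht] with s hs using hankelZero_eq hs

/-- Decay of `H₀⁽¹⁾'` and the radiation condition, away from the origin. -/
theorem exists_hankelDeriv_bounds {a : ℝ} (ha : 0 < a) : ∃ C, 0 < C ∧ ∀ t, a ≤ t →
    ‖hankelDeriv 1 t‖ ≤ C * t ^ (-(1 / 2) : ℝ) ∧
    ‖hankelDeriv 2 t - Complex.I * hankelDeriv 1 t‖ ≤ C * t ^ (-(3 / 2) : ℝ) := by
  obtain ⟨C1, h1⟩ := exists_norm_hankelIntegral_one_le ha
  obtain ⟨C2, h2⟩ := exists_norm_hankelIntegral_radiation_le ha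
  set c : ℂ := -(2 * Complex.I / Real.pi)
  refine ⟨‖c‖ * (|C1| + |C2|) + 1, by positivity, fun t ht => ⟨?_, ?_⟩⟩
  · have ht0 : 0 < t := ha.trans_le ht
    rw [hankelDeriv, norm_mul]
    have hp : 0 ≤ t ^ (-(1 / 2) : ℝ) := by positivity
    calc ‖c‖ * ‖hankelIntegral 1 t‖ ≤ ‖c‖ * (C1 * t ^ (-(1 / 2) : ℝ)) := by gcongr; exact h1 t ht
      _ = ‖c‖ * C1 * t ^ (-(1 / 2) : ℝ) := by ring
      _ ≤ _ := by
        gcongr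
        have : ‖c‖ * C1 ≤ ‖c‖ * (|C1| + |C2|) := by
          gcongr
          linarith [le_abs_self C1, abs_nonneg C2]
        linarith
  · have ht0 : 0 < t := ha.trans_le ht
    have e : hankelDeriv 2 t - Complex.I * hankelDeriv 1 t
        = c * (hankelIntegral 2 t - Complex.I * hankelIntegral 1 t) := by
      simp only [hankelDeriv, c]; ring
    rw [e, norm_mul]
    calc ‖c‖ * ‖hankelIntegral 2 t - Complex.I * hankelIntegral 1 t‖
        ≤ ‖c‖ * (C2 * t ^ (-(3 / 2) : ℝ)) := by gcongr; exact h2 t ht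
      _ = ‖c‖ * C2 * t ^ (-(3 / 2) : ℝ) := by ring
      _ ≤ _ := by
        gcongr
        have : ‖c‖ * C2 ≤ ‖c‖ * (|C1| + |C2|) := by
          gcongr
          linarith [le_abs_self C2, abs_nonneg C1]
        linarith

/-! ### The layer kernel and its gradient -/

theorem norm_sub_mk (x : Plane) (a s : ℝ) :
    ‖x - !₂[a, s]‖ = √((x 0 - a) ^ 2 + (x 1 - s) ^ 2) := by
  rw [EuclideanSpace.norm_eq, Fin.sum_univ_two]
  simp

/-- The distance from `x` to a point of the line is at least the height of `x` over the line. -/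
theorem height_le_norm_sub_linePt (H t : ℝ) (x : Plane) : x 1 - H ≤ ‖x - linePt H t‖ := by
  have h := PiLp.norm_apply_le (x - linePt H t) 1
  refine (le_abs_self _).trans (le_trans (le_of_eq ?_) h)
  simp [linePt]

theorem height_le_radius (H : ℝ) (x : Plane) : x 1 - H ≤ radius H x :=
  height_le_norm_sub_linePt H 0 x

/-- `∂Φ/∂y₂ = (x₂ - H) layerProfile(|x - y|)` for `y` on the line at height `H`. -/
noncomputable def layerProfile (k ρ : ℝ) : ℂ := -(Complex.I / 4) * k * (hankelDeriv 1 (k * ρ) / ρ)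

/-- The derivative of `layerProfile k`. -/
noncomputable def layerProfileDeriv (k ρ : ℝ) : ℂ :=
  -(Complex.I / 4) * k * (k * hankelDeriv 2 (k * ρ) / ρ - hankelDeriv 1 (k * ρ) / ρ ^ 2)

theorem hasDerivAt_layerProfile {k ρ : ℝ} (hk : 0 < k) (hρ : 0 < ρ) :
    HasDerivAt (layerProfile k) (layerProfileDeriv k ρ) ρ := by
  have h1 : HasDerivAt (fun ρ : ℝ => hankelDeriv 1 (k * ρ)) (k • hankelDeriv 2 (k * ρ)) ρ := by
    have h := (hasDerivAt_hankelDeriv 1 (mul_pos hk hρ)).scomp ρ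
      ((hasDerivAt_id ρ).const_mul k)
    rw [mul_one] at h
    exact h
  have hρ0 : (ρ : ℂ) ≠ 0 := by exact_mod_cast hρ.ne'
  refine ((h1.div (Complex.ofRealCLM.hasDerivAt (x := ρ)) hρ0).const_mul
    (-(Complex.I / 4) * k)).congr_deriv ?_
  rw [layerProfileDeriv, Complex.real_smul]
  simp only [Complex.ofRealCLM_apply, Complex.ofReal_one]
  field_simp

theorem layerKernel_linePt {k H : ℝ} (hk : 0 < k) {x : Plane} (hx : H < x 1) (t : ℝ) :
    layerKernel k x (linePt H t) = (x 1 - H : ℝ) • layerProfile k ‖x - linePt H t‖ := by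
  have hR : 0 < ‖x - linePt H t‖ := (sub_pos.2 hx).trans_le (height_le_norm_sub_linePt H t x)
  have hnorm : HasDerivAt (fun s : ℝ => ‖x - !₂[t, s]‖) (-(x 1 - H) / ‖x - linePt H t‖) H := by
    simp only [linePt, norm_sub_mk] at hR ⊢
    have h := (((hasDerivAt_id H).const_sub (x 1)).pow 2).const_add ((x 0 - t) ^ 2)
    refine (h.sqrt (Real.sqrt_pos.1 hR).ne').congr_deriv ?_
    simp only [id, Pi.pow_apply]
    field_simp
    ring
  have h : HasDerivAt (fun s : ℝ => fundSol k x !₂[t, s])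
      (Complex.I / 4 * ((k * (-(x 1 - H) / ‖x - linePt H t‖))
        • hankelDeriv 1 (k * ‖x - linePt H t‖))) H :=
    ((hasDerivAt_hankelZero (mul_pos hk hR)).scomp H (hnorm.const_mul k)).const_mul _
  have e : layerKernel k x (linePt H t) = deriv (fun s : ℝ => fundSol k x !₂[t, s]) H := by
    simp [layerKernel, linePt]
  rw [e, h.deriv, layerProfile, Complex.real_smul, Complex.real_smul]
  have hR0 : (‖x - linePt H t‖ : ℂ) ≠ 0 := by exact_mod_cast hR.ne'
  push_cast
  field_simp

/-- The gradient of `x ↦ ∂Φ(x, y)/∂y₂`, as a linear form, for `y = (t, H)`. -/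
noncomputable def layerGrad (k H t : ℝ) (x : Plane) : Plane →L[ℝ] ℂ :=
  (x 1 - H) • ContinuousLinearMap.smulRightL ℝ Plane ℂ
      (‖x - linePt H t‖⁻¹ • innerSL ℝ (x - linePt H t)) (layerProfileDeriv k ‖x - linePt H t‖)
    + ContinuousLinearMap.smulRightL ℝ Plane ℂ (EuclideanSpace.proj 1)
      (layerProfile k ‖x - linePt H t‖)

theorem layerGrad_apply (k H t : ℝ) (x v : Plane) : layerGrad k H t x v
    = ((x 1 - H) * (‖x - linePt H t‖⁻¹ * inner ℝ (x - linePt H t) v) : ℝ)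
        * layerProfileDeriv k ‖x - linePt H t‖ + (v 1 : ℝ) * layerProfile k ‖x - linePt H t‖ := by
  simp [layerGrad, inner_sub_left]
  ring

theorem hasFDerivAt_layerKernel {k H : ℝ} (hk : 0 < k) {x : Plane} (hx : H < x 1) (t : ℝ) :
    HasFDerivAt (fun z => layerKernel k z (linePt H t)) (layerGrad k H t x) x := by
  have hR : 0 < ‖x - linePt H t‖ := (sub_pos.2 hx).trans_le (height_le_norm_sub_linePt H t x)
  have hev : (fun z => layerKernel k z (linePt H t)) =ᶠ[𝓝 x]
      fun z => (z 1 - H : ℝ) • layerProfile k ‖z - linePt H t‖ := by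
    have : {z : Plane | H < z 1} ∈ 𝓝 x :=
      (isOpen_lt continuous_const (EuclideanSpace.proj (𝕜 := ℝ) (1 : Fin 2)).continuous).mem_nhds hx
    filter_upwards [this] with z hz using layerKernel_linePt hk hz t
  refine HasFDerivAt.congr_of_eventuallyEq ?_ hev
  have hn : HasFDerivAt (fun z : Plane => ‖z - linePt H t‖)
      (‖x - linePt H t‖⁻¹ • innerSL ℝ (x - linePt H t)) x := by
    have h := ((hasFDerivAt_id x).sub_const (linePt H t)).norm_sq.sqrt (by positivity)
    simp only [id, Real.sqrt_sq (norm_nonneg _)] at h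
    refine h.congr_fderiv ?_
    ext v
    simp
    field_simp
  have hc : HasFDerivAt (fun z : Plane => z 1 - H) (EuclideanSpace.proj (𝕜 := ℝ) (1 : Fin 2)) x :=
    (EuclideanSpace.proj (𝕜 := ℝ) (1 : Fin 2)).hasFDerivAt.sub_const H
  refine (hc.smul ((hasDerivAt_layerProfile hk hR).hasFDerivAt.comp x hn)).congr_fderiv ?_
  ext v
  rw [layerGrad_apply]
  simp [inner_sub_left]
  ring

theorem continuous_linePt (H : ℝ) : Continuous (linePt H) := by
  unfold linePt
  refine (PiLp.continuous_toLp 2 _).comp (continuous_pi fun i => ?_)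
  fin_cases i
  · exact continuous_id
  · exact continuous_const

theorem continuousAt_hankelDeriv (n : ℕ) {t : ℝ} (ht : 0 < t) : ContinuousAt (hankelDeriv n) t :=
  (hasDerivAt_hankelDeriv n ht).continuousAt

theorem continuous_layerGrad {k H : ℝ} (hk : 0 < k) {x : Plane} (hx : H < x 1) :
    Continuous fun t => layerGrad k H t x := by
  have hR : ∀ t, 0 < ‖x - linePt H t‖ := fun t =>
    (sub_pos.2 hx).trans_le (height_le_norm_sub_linePt H t x)
  have hl := continuous_linePt H
  have hc : Continuous fun t => ‖x - linePt H t‖ := (continuous_const.sub hl).norm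
  have hcC : Continuous fun t => (‖x - linePt H t‖ : ℂ) := Complex.continuous_ofReal.comp hc
  have hcC0 : ∀ t, (‖x - linePt H t‖ : ℂ) ≠ 0 := fun t => by exact_mod_cast (hR t).ne'
  have hH : ∀ n, Continuous fun t => hankelDeriv n (k * ‖x - linePt H t‖) := fun n =>
    continuous_iff_continuousAt.2 fun t =>
      (continuousAt_hankelDeriv n (mul_pos hk (hR t))).comp
        (f := fun t => k * ‖x - linePt H t‖) (hc.const_mul k).continuousAt
  have hp : Continuous fun t => layerProfile k ‖x - linePt H t‖ :=
    continuous_const.mul ((hH 1).div hcC hcC0)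
  have hp' : Continuous fun t => layerProfileDeriv k ‖x - linePt H t‖ :=
    continuous_const.mul (((continuous_const.mul (hH 2)).div hcC hcC0).sub
      ((hH 1).div (hcC.pow 2) fun t => pow_ne_zero 2 (hcC0 t)))
  have hi : Continuous fun t => ‖x - linePt H t‖⁻¹ • innerSL ℝ (x - linePt H t) :=
    (hc.inv₀ fun t => (hR t).ne').smul ((innerSL ℝ).continuous.comp (continuous_const.sub hl))
  unfold layerGrad
  exact ((((ContinuousLinearMap.smulRightL ℝ Plane ℂ).continuous.comp hi).clm_apply
    hp').const_smul (x 1 - H)).add ((ContinuousLinearMap.smulRightL ℝ Plane ℂ _).continuous.comp hp)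

theorem continuous_layerKernel {k H : ℝ} (hk : 0 < k) {x : Plane} (hx : H < x 1) :
    Continuous fun t => layerKernel k x (linePt H t) := by
  have hR : ∀ t, 0 < ‖x - linePt H t‖ := fun t =>
    (sub_pos.2 hx).trans_le (height_le_norm_sub_linePt H t x)
  have hc : Continuous fun t => ‖x - linePt H t‖ :=
    (continuous_const.sub (continuous_linePt H)).norm
  simp only [layerKernel_linePt hk hx]
  have h : Continuous fun t => layerProfile k ‖x - linePt H t‖ :=
    continuous_iff_continuousAt.2 fun t => (hasDerivAt_layerProfile hk (hR t)).continuousAt.comp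
      (f := fun t => ‖x - linePt H t‖) hc.continuousAt
  exact h.const_smul (x 1 - H)

/-- The unit vector in the radial direction. -/
noncomputable def radialDir (H : ℝ) (x : Plane) : Plane := (radius H x)⁻¹ • (x - centre H)

theorem radiationKernel_linePt {k H : ℝ} (hk : 0 < k) {x : Plane} (hx : H < x 1) (t : ℝ) :
    radiationKernel k H x (linePt H t) = layerGrad k H t x (radialDir H x)
      - Complex.I * k * layerKernel k x (linePt H t) := by
  rw [radiationKernel, radialDeriv, (hasFDerivAt_layerKernel hk hx t).fderiv, radialDir]

/-- The cosine of the angle between `x - y` and `x - (0, H)`, for `y = (t, H)`; this is `∂|x-y|/∂r`.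
-/
noncomputable def cosAngle (H t : ℝ) (x : Plane) : ℝ :=
  ‖x - linePt H t‖⁻¹ * inner ℝ (x - linePt H t) (radialDir H x)

theorem norm_radialDir {H : ℝ} {x : Plane} (hx : H < x 1) : ‖radialDir H x‖ = 1 := by
  have hr : 0 < radius H x := (sub_pos.2 hx).trans_le (height_le_radius H x)
  rw [radialDir, norm_smul, norm_inv, Real.norm_eq_abs, abs_of_pos hr]
  exact inv_mul_cancel₀ hr.ne'

theorem abs_cosAngle_le_one {H : ℝ} {x : Plane} (hx : H < x 1) (t : ℝ) : |cosAngle H t x| ≤ 1 := by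
  have hR : 0 < ‖x - linePt H t‖ := (sub_pos.2 hx).trans_le (height_le_norm_sub_linePt H t x)
  have h := abs_real_inner_le_norm (x - linePt H t) (radialDir H x)
  rw [norm_radialDir hx, mul_one] at h
  rw [cosAngle, abs_mul, abs_inv, abs_norm, inv_mul_le_iff₀ hR, mul_one]
  exact h

theorem norm_linePt_sub_centre (H t : ℝ) : ‖linePt H t - centre H‖ = |t| := by
  rw [centre, norm_sub_mk]
  simp [linePt, Real.sqrt_sq_eq_abs]

/-- `2 (|a| |b| - a · b) = |a - b|² - (|a| - |b|)²` with `|a - b| = |t|`. -/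
theorem one_sub_cosAngle_le {H : ℝ} {x : Plane} (hx : H < x 1) (t : ℝ) :
    1 - cosAngle H t x ≤ t ^ 2 / (2 * ‖x - linePt H t‖ * radius H x) := by
  have hR : 0 < ‖x - linePt H t‖ := (sub_pos.2 hx).trans_le (height_le_norm_sub_linePt H t x)
  have hr : 0 < radius H x := (sub_pos.2 hx).trans_le (height_le_radius H x)
  have h := norm_sub_sq_real (x - linePt H t) (x - centre H)
  have e : x - linePt H t - (x - centre H) = -(linePt H t - centre H) := by abel
  rw [e, norm_neg, norm_linePt_sub_centre, sq_abs] at h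
  change t ^ 2 = _ - _ + radius H x ^ 2 at h
  rw [cosAngle, radialDir, inner_smul_right, le_div_iff₀ (by positivity)]
  have e2 : (1 - ‖x - linePt H t‖⁻¹ * ((radius H x)⁻¹ * inner ℝ (x - linePt H t) (x - centre H)))
      * (2 * ‖x - linePt H t‖ * radius H x)
      = 2 * ‖x - linePt H t‖ * radius H x - 2 * inner ℝ (x - linePt H t) (x - centre H) := by
    field_simp
  rw [e2]
  nlinarith [sq_nonneg (‖x - linePt H t‖ - radius H x)]

/-- The kernel `K` splits into a part governed by the radiation condition, a part measuring the
deviation of `x - y` from the radial direction, and a part with an additional factor `1/|x-y|`. -/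
theorem radiationKernel_decomp {k H : ℝ} (hk : 0 < k) {x : Plane} (hx : H < x 1) (t : ℝ) :
    radiationKernel k H x (linePt H t) = -(Complex.I / 4) * k *
      ((((x 1 - H) / ‖x - linePt H t‖ * cosAngle H t x * k : ℝ) : ℂ)
          * (hankelDeriv 2 (k * ‖x - linePt H t‖)
            - Complex.I * hankelDeriv 1 (k * ‖x - linePt H t‖))
        - Complex.I * (((x 1 - H) / ‖x - linePt H t‖ * (k * (1 - cosAngle H t x)) : ℝ) : ℂ)
          * hankelDeriv 1 (k * ‖x - linePt H t‖)
        + ((((x 1 - H) / radius H x - (x 1 - H) / ‖x - linePt H t‖ * cosAngle H t x)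
            / ‖x - linePt H t‖ : ℝ) : ℂ) * hankelDeriv 1 (k * ‖x - linePt H t‖)) := by
  have hR : 0 < ‖x - linePt H t‖ := (sub_pos.2 hx).trans_le (height_le_norm_sub_linePt H t x)
  have hr : 0 < radius H x := (sub_pos.2 hx).trans_le (height_le_radius H x)
  have hR0 : (‖x - linePt H t‖ : ℂ) ≠ 0 := by exact_mod_cast hR.ne'
  have hr0 : (radius H x : ℂ) ≠ 0 := by exact_mod_cast hr.ne'
  have e : radialDir H x 1 = (x 1 - H) / radius H x := by
    simp [radialDir, centre]; ring
  rw [radiationKernel_linePt hk hx, layerGrad_apply, layerKernel_linePt hk hx, e, ← cosAngle,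
    Complex.real_smul, layerProfile, layerProfileDeriv]
  push_cast
  field_simp
  ring

/-- Pointwise bounds for both kernels in terms of the angle between `x - y` and the radial
direction. -/
theorem exists_kernel_bounds {k h : ℝ} (hk : 0 < k) (hh : 0 < h) (H : ℝ) :
    ∃ A, 0 < A ∧ ∀ x : Plane, H + h ≤ x 1 → ∀ t : ℝ,
      ‖layerKernel k x (linePt H t)‖ ≤ A * ‖x - linePt H t‖ ^ (-(1 / 2) : ℝ) ∧
      ‖radiationKernel k H x (linePt H t)‖ ≤ A * ‖x - linePt H t‖ ^ (-(1 / 2) : ℝ)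
        * (3 / ‖x - linePt H t‖ + k * (1 - cosAngle H t x)) ∧
      ‖layerGrad k H t x‖ ≤ A := by
  obtain ⟨C, hC, hb⟩ := exists_hankelDeriv_bounds (mul_pos hk hh)
  set A := k / 4 * (C * k ^ (-(1 / 2) : ℝ)) with hA
  have hA0 : 0 < A := by positivity
  set G := A * h ^ (-(1 / 2) : ℝ) * (3 / h + k) with hG
  have hG0 : 0 < G := by positivity
  refine ⟨A + G, by positivity, fun x hx t => ?_⟩
  have hxH : H < x 1 := by linarith
  have hd : 0 < x 1 - H := by linarith
  set R := ‖x - linePt H t‖ with hRdef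
  have hdR : x 1 - H ≤ R := height_le_norm_sub_linePt H t x
  have hhR : h ≤ R := by linarith
  have hR : 0 < R := hh.trans_le hhR
  have hdr : x 1 - H ≤ radius H x := height_le_radius H x
  have hr : 0 < radius H x := hd.trans_le hdr
  have hdR1 : (x 1 - H) / R ≤ 1 := (div_le_one hR).2 hdR
  have hdr1 : (x 1 - H) / radius H x ≤ 1 := (div_le_one hr).2 hdr
  have hdR0 : 0 ≤ (x 1 - H) / R := by positivity
  have hdr0 : 0 ≤ (x 1 - H) / radius H x := by positivity
  have hc := abs_le.1 (abs_cosAngle_le_one hxH t)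
  obtain ⟨h1, h2⟩ := hb (k * R) (by gcongr)
  have e2 : (k * R) ^ (-(3 / 2) : ℝ) = (k * R) ^ (-(1 / 2) : ℝ) / (k * R) := by
    rw [← Real.rpow_sub_one (by positivity)]; norm_num
  set P := C * (k * R) ^ (-(1 / 2) : ℝ) with hP
  have hP0 : 0 ≤ P := by positivity
  rw [e2, ← mul_div_assoc, ← hP] at h2
  have hPA : k / 4 * P = A * R ^ (-(1 / 2) : ℝ) := by
    rw [hP, hA, Real.mul_rpow hk.le hR.le]; ring
  have hpre : ‖-(Complex.I / 4) * (k : ℂ)‖ = k / 4 := by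
    simp [abs_of_pos hk]; ring
  have hprof : R * ‖layerProfile k R‖ ≤ k / 4 * P := by
    rw [layerProfile, norm_mul, hpre, norm_div, Complex.norm_real, Real.norm_eq_abs, abs_of_pos hR]
    have : R * (k / 4 * (‖hankelDeriv 1 (k * R)‖ / R)) = k / 4 * ‖hankelDeriv 1 (k * R)‖ := by
      field_simp
    rw [this]
    gcongr
  have hRp : 0 ≤ R ^ (-(1 / 2) : ℝ) := by positivity
  refine ⟨?_, ?_, ?_⟩
  · rw [layerKernel_linePt hk hxH, norm_smul, Real.norm_eq_abs, abs_of_pos hd]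
    calc (x 1 - H) * ‖layerProfile k R‖ ≤ R * ‖layerProfile k R‖ := by gcongr
      _ ≤ A * R ^ (-(1 / 2) : ℝ) := hprof.trans_eq hPA
      _ ≤ _ := by gcongr; linarith
  · rw [radiationKernel_decomp hk hxH, norm_mul, hpre]
    have hcos : 0 ≤ 1 - cosAngle H t x := by linarith [hc.2]
    have n1 : |(x 1 - H) / R * cosAngle H t x * k| ≤ k := by
      rw [abs_mul, abs_mul, abs_of_pos hk, abs_of_nonneg hdR0]
      exact mul_le_of_le_one_left hk.le
        (mul_le_one₀ hdR1 (abs_nonneg _) (abs_cosAngle_le_one hxH t))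
    have n2 : |(x 1 - H) / R * (k * (1 - cosAngle H t x))| ≤ k * (1 - cosAngle H t x) := by
      rw [abs_of_nonneg (by positivity)]
      exact mul_le_of_le_one_left (by positivity) hdR1
    have n3 : |((x 1 - H) / radius H x - (x 1 - H) / R * cosAngle H t x) / R| ≤ 2 / R := by
      rw [abs_div, abs_of_pos hR]
      gcongr
      have := mul_le_one₀ hdR1 (abs_nonneg _) (abs_cosAngle_le_one hxH t)
      refine (abs_sub _ _).trans ?_
      rw [abs_mul, abs_of_nonneg hdR0, abs_of_nonneg hdr0]
      linarith
    have hsum := (norm_add_le _ _).trans (add_le_add_left (norm_sub_le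
      ((((x 1 - H) / R * cosAngle H t x * k : ℝ) : ℂ)
          * (hankelDeriv 2 (k * R) - Complex.I * hankelDeriv 1 (k * R)))
      (Complex.I * (((x 1 - H) / R * (k * (1 - cosAngle H t x)) : ℝ) : ℂ) * hankelDeriv 1 (k * R)))
      ‖((((x 1 - H) / radius H x - (x 1 - H) / R * cosAngle H t x) / R : ℝ) : ℂ)
        * hankelDeriv 1 (k * R)‖)
    simp only [norm_mul, Complex.norm_I, one_mul, Complex.norm_real, Real.norm_eq_abs] at hsum
    have hfin : k / 4 * (k * (P / (k * R)) + k * (1 - cosAngle H t x) * P + 2 / R * P)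
        = A * R ^ (-(1 / 2) : ℝ) * (3 / R + k * (1 - cosAngle H t x)) := by
      rw [← hPA]; field_simp; ring
    calc _ ≤ k / 4 * (k * (P / (k * R)) + k * (1 - cosAngle H t x) * P + 2 / R * P) := by
          refine mul_le_mul_of_nonneg_left (hsum.trans ?_) (by positivity)
          simp only [← abs_mul] at n1 n2 n3 ⊢
          gcongr
      _ = _ := hfin
      _ ≤ _ := by gcongr; linarith
  · have hRh : R ^ (-(1 / 2) : ℝ) ≤ h ^ (-(1 / 2) : ℝ) :=
      Real.rpow_le_rpow_of_nonpos hh hhR (by norm_num)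
    have h2' : ‖hankelDeriv 2 (k * R)‖ ≤ P / (k * R) + P := by
      have e : hankelDeriv 2 (k * R) = (hankelDeriv 2 (k * R) - Complex.I * hankelDeriv 1 (k * R))
          + Complex.I * hankelDeriv 1 (k * R) := by ring
      rw [e]
      refine (norm_add_le _ _).trans (add_le_add h2 ?_)
      rw [norm_mul, Complex.norm_I, one_mul]
      exact h1
    have hprof' : R * ‖layerProfileDeriv k R‖ ≤ k / 4 * P * (2 / R + k) := by
      rw [layerProfileDeriv, norm_mul, hpre]
      have h3 := norm_sub_le (k * hankelDeriv 2 (k * R) / R) (hankelDeriv 1 (k * R) / (R : ℂ) ^ 2)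
      rw [norm_div, norm_div, norm_mul, norm_pow, Complex.norm_real, Complex.norm_real,
        Real.norm_eq_abs, Real.norm_eq_abs, abs_of_pos hR, abs_of_pos hk] at h3
      calc _ ≤ R * (k / 4 * (k * (P / (k * R) + P) / R + P / R ^ 2)) := by
            gcongr
            refine h3.trans ?_
            gcongr
        _ = _ := by field_simp; ring
    have hbound : ‖layerGrad k H t x‖ ≤ R * ‖layerProfileDeriv k R‖ + ‖layerProfile k R‖ := by
      refine ContinuousLinearMap.opNorm_le_bound _ (by positivity) fun v => ?_
      rw [layerGrad_apply]
      refine (norm_add_le _ _).trans ?_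
      rw [norm_mul, norm_mul, Complex.norm_real, Complex.norm_real, add_mul]
      have hv : ‖v 1‖ ≤ ‖v‖ := PiLp.norm_apply_le v 1
      have hi := abs_real_inner_le_norm (x - linePt H t) v
      have hi' : ‖(x 1 - H) * (R⁻¹ * inner ℝ (x - linePt H t) v)‖ ≤ R * ‖v‖ := by
        rw [Real.norm_eq_abs, abs_mul, abs_mul, abs_of_pos hd, abs_of_pos (inv_pos.2 hR)]
        have : R⁻¹ * |inner ℝ (x - linePt H t) v| ≤ ‖v‖ := by
          rw [inv_mul_le_iff₀ hR]; exact hi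
        gcongr
      refine add_le_add ?_ ?_
      · calc _ ≤ R * ‖v‖ * ‖layerProfileDeriv k R‖ := by gcongr
          _ = _ := by ring
      · rw [mul_comm]
        gcongr
    have hp2 : ‖layerProfile k R‖ ≤ k / 4 * P * (1 / R) := by
      rw [mul_one_div, le_div_iff₀ hR, mul_comm]; exact hprof
    calc _ ≤ k / 4 * P * (2 / R + k) + k / 4 * P * (1 / R) :=
          hbound.trans (add_le_add hprof' hp2)
      _ = A * R ^ (-(1 / 2) : ℝ) * (3 / R + k) := by rw [← hPA]; ring
      _ ≤ G := by rw [hG]; gcongr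
      _ ≤ A + G := by linarith

/-! ### Densities with super-algebraic decay -/

theorem SuperAlgebraicDecay.exists_bound {H : ℝ} {φ : ℝ → ℂ} (hφ : SuperAlgebraicDecay H φ) :
    ∃ B, 0 ≤ B ∧ ∀ t, ‖φ t‖ ≤ B / (1 + t ^ 2) ^ 3 := by
  obtain ⟨B, hB⟩ := hφ 3
  refine ⟨|B|, abs_nonneg B, fun t => (hB t).trans ?_⟩
  have e : t ^ 2 ≤ ‖linePt H t‖ ^ 2 := by
    have h := PiLp.norm_apply_le (linePt H t) 0
    exact sq_le_sq' (by linarith [neg_abs_le t, (show ‖linePt H t 0‖ = |t| by simp [linePt])])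
      (by linarith [le_abs_self t, (show ‖linePt H t 0‖ = |t| by simp [linePt])])
  gcongr
  exact le_abs_self B

/-- Powers of `1/|x-y|` are comparable to powers of `1/r`, up to polynomial growth in `t`, because
`r ≤ |x-y| + |t| ≤ |x-y| (1 + |t| / h)`. -/
theorem rpow_neg_norm_sub_linePt_le {H h : ℝ} (hh : 0 < h) {p : ℝ} (hp : 0 ≤ p) (hp2 : p ≤ 2)
    {x : Plane} (hx : H + h ≤ x 1) (t : ℝ) :
    ‖x - linePt H t‖ ^ (-p) ≤ 2 * (1 + 1 / h ^ 2) * (1 + t ^ 2) * radius H x ^ (-p) := by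
  have hd : 0 < x 1 - H := by linarith
  have hhR : h ≤ ‖x - linePt H t‖ := by linarith [height_le_norm_sub_linePt H t x]
  have hR : 0 < ‖x - linePt H t‖ := hh.trans_le hhR
  have hr : 0 < radius H x := hd.trans_le (height_le_radius H x)
  have htri : radius H x ≤ ‖x - linePt H t‖ * (1 + |t| / h) := by
    have h1 := norm_add_le (x - linePt H t) (linePt H t - centre H)
    rw [norm_linePt_sub_centre, sub_add_sub_cancel] at h1
    have h2 : |t| ≤ ‖x - linePt H t‖ * (|t| / h) := by
      rw [← mul_div_assoc, le_div_iff₀ hh, mul_comm]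
      gcongr
    rw [radius]
    linarith
  have ha : 0 ≤ |t| / h := by positivity
  have h1 : radius H x ^ p ≤ ‖x - linePt H t‖ ^ p * (1 + |t| / h) ^ p := by
    rw [← Real.mul_rpow hR.le (by positivity)]
    exact Real.rpow_le_rpow hr.le htri hp
  have h2 : (1 + |t| / h) ^ p ≤ 2 * (1 + 1 / h ^ 2) * (1 + t ^ 2) := by
    calc (1 + |t| / h) ^ p ≤ (1 + |t| / h) ^ (2 : ℝ) :=
          Real.rpow_le_rpow_of_exponent_le (by linarith) hp2
      _ = (1 + |t| / h) ^ 2 := Real.rpow_two _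
      _ ≤ 2 * (1 + (|t| / h) ^ 2) := by nlinarith [sq_nonneg (|t| / h - 1)]
      _ = 2 * (1 + t ^ 2 / h ^ 2) := by rw [div_pow, sq_abs]
      _ ≤ 2 * (1 + t ^ 2 / h ^ 2 + (t ^ 2 + 1 / h ^ 2)) := by
        have : 0 ≤ t ^ 2 + 1 / h ^ 2 := by positivity
        linarith
      _ = _ := by ring
  rw [Real.rpow_neg hR.le, Real.rpow_neg hr.le, ← div_eq_mul_inv, inv_eq_one_div,
    div_le_div_iff₀ (by positivity) (by positivity), one_mul]
  refine h1.trans ?_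
  rw [mul_comm]
  gcongr

/-- With `p` powers of `1/r` split off, both kernels grow at most polynomially in `t`. -/
theorem exists_kernel_weighted_bounds {k h : ℝ} (hk : 0 < k) (hh : 0 < h) (H : ℝ) :
    ∃ A, 0 < A ∧ ∀ x : Plane, H + h ≤ x 1 → ∀ t : ℝ,
      ‖layerKernel k x (linePt H t)‖ ≤ A * radius H x ^ (-(1 / 2) : ℝ) * (1 + t ^ 2) ^ 2 ∧
      ‖radiationKernel k H x (linePt H t)‖ ≤
        A * radius H x ^ (-(3 / 2) : ℝ) * (1 + t ^ 2) ^ 2 := by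
  obtain ⟨A, hA, hb⟩ := exists_kernel_bounds hk hh H
  refine ⟨A * (2 * (1 + 1 / h ^ 2)) * (1 + (3 + k / (2 * h))), by positivity,
    fun x hx t => ?_⟩
  have hxH : H < x 1 := by linarith
  have hd : 0 < x 1 - H := by linarith
  have hhr : h ≤ radius H x := by linarith [height_le_radius H x]
  have hr : 0 < radius H x := hh.trans_le hhr
  have hR : 0 < ‖x - linePt H t‖ := by linarith [height_le_norm_sub_linePt H t x]
  obtain ⟨h1, h2, -⟩ := hb x hx t
  have ht : 1 ≤ 1 + t ^ 2 := by linarith [sq_nonneg t]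
  constructor
  · have hq := rpow_neg_norm_sub_linePt_le hh (p := 1 / 2) (by norm_num) (by norm_num) hx t
    have hk2 : 0 ≤ 3 + k / (2 * h) := by positivity
    calc _ ≤ A * (2 * (1 + 1 / h ^ 2) * (1 + t ^ 2) * radius H x ^ (-(1 / 2) : ℝ)) :=
          h1.trans (by gcongr)
      _ = A * (2 * (1 + 1 / h ^ 2)) * 1 * radius H x ^ (-(1 / 2) : ℝ) * ((1 + t ^ 2) * 1) := by ring
      _ ≤ A * (2 * (1 + 1 / h ^ 2)) * (1 + (3 + k / (2 * h))) * radius H x ^ (-(1 / 2) : ℝ)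
          * ((1 + t ^ 2) * (1 + t ^ 2)) := by gcongr; linarith
      _ = _ := by ring
  · have hq := rpow_neg_norm_sub_linePt_le hh (p := 3 / 2) (by norm_num) (by norm_num) hx t
    have e : ‖x - linePt H t‖ ^ (-(3 / 2) : ℝ)
        = ‖x - linePt H t‖ ^ (-(1 / 2) : ℝ) / ‖x - linePt H t‖ := by
      rw [← Real.rpow_sub_one hR.ne']; norm_num
    have hcos : 3 / ‖x - linePt H t‖ + k * (1 - cosAngle H t x)
        ≤ (1 + (3 + k / (2 * h))) * (1 + t ^ 2) / ‖x - linePt H t‖ := by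
      calc 3 / ‖x - linePt H t‖ + k * (1 - cosAngle H t x)
          ≤ 3 / ‖x - linePt H t‖ + k * (t ^ 2 / (2 * ‖x - linePt H t‖ * radius H x)) := by
            gcongr; exact one_sub_cosAngle_le hxH t
        _ ≤ 3 / ‖x - linePt H t‖ + k * (t ^ 2 / (2 * ‖x - linePt H t‖ * h)) := by gcongr
        _ = (3 + k / (2 * h) * t ^ 2) / ‖x - linePt H t‖ := by field_simp
        _ ≤ _ := by
            gcongr
            have : 0 ≤ k / (2 * h) := by positivity
            nlinarith [sq_nonneg t]
    calc _ ≤ A * ‖x - linePt H t‖ ^ (-(1 / 2) : ℝ)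
          * ((1 + (3 + k / (2 * h))) * (1 + t ^ 2) / ‖x - linePt H t‖) := h2.trans (by gcongr)
      _ = A * (1 + (3 + k / (2 * h))) * (1 + t ^ 2) * ‖x - linePt H t‖ ^ (-(3 / 2) : ℝ) := by
          rw [e]; ring
      _ ≤ A * (1 + (3 + k / (2 * h))) * (1 + t ^ 2)
          * (2 * (1 + 1 / h ^ 2) * (1 + t ^ 2) * radius H x ^ (-(3 / 2) : ℝ)) := by gcongr
      _ = _ := by ring

theorem norm_mul_le_of_weighted {φ : ℝ → ℂ} {B : ℝ} (hφ : ∀ t, ‖φ t‖ ≤ B / (1 + t ^ 2) ^ 3)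
    {g : ℝ → ℂ} {M : ℝ} (hg : ∀ t, ‖g t‖ ≤ M * (1 + t ^ 2) ^ 2) (t : ℝ) :
    ‖g t * φ t‖ ≤ M * B * (1 + t ^ 2)⁻¹ := by
  have ht : 0 < 1 + t ^ 2 := by positivity
  have hg0 := (norm_nonneg _).trans (hg t)
  rw [norm_mul]
  calc ‖g t‖ * ‖φ t‖ ≤ M * (1 + t ^ 2) ^ 2 * (B / (1 + t ^ 2) ^ 3) :=
        mul_le_mul (hg t) (hφ t) (norm_nonneg _) hg0
    _ = _ := by field_simp

theorem integrable_mul_of_weighted {φ : ℝ → ℂ} {B : ℝ} (hm : AEStronglyMeasurable φ volume)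
    (hφ : ∀ t, ‖φ t‖ ≤ B / (1 + t ^ 2) ^ 3) {g : ℝ → ℂ} (hgc : Continuous g) {M : ℝ}
    (hg : ∀ t, ‖g t‖ ≤ M * (1 + t ^ 2) ^ 2) : Integrable fun t => g t * φ t :=
  Integrable.mono' (integrable_inv_one_add_sq.const_mul (M * B))
    (hgc.aestronglyMeasurable.mul hm) (ae_of_all _ (norm_mul_le_of_weighted hφ hg))

theorem norm_integral_mul_le_of_weighted {φ : ℝ → ℂ} {B : ℝ}
    (hφ : ∀ t, ‖φ t‖ ≤ B / (1 + t ^ 2) ^ 3) {g : ℝ → ℂ} {M : ℝ}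
    (hg : ∀ t, ‖g t‖ ≤ M * (1 + t ^ 2) ^ 2) : ‖∫ t, g t * φ t‖ ≤ M * B * Real.pi := by
  refine (norm_integral_le_of_norm_le (integrable_inv_one_add_sq.const_mul (M * B))
    (ae_of_all _ (norm_mul_le_of_weighted hφ hg))).trans_eq ?_
  rw [integral_const_mul, integral_univ_inv_one_add_sq]

theorem integrable_layerKernel_mul {k H h : ℝ} (hk : 0 < k) (hh : 0 < h) {φ : ℝ → ℂ}
    (hm : AEStronglyMeasurable φ volume) (hφ : SuperAlgebraicDecay H φ) {x : Plane}
    (hx : H + h ≤ x 1) : Integrable fun t => layerKernel k x (linePt H t) * φ t := by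
  obtain ⟨B, _, hB⟩ := hφ.exists_bound
  obtain ⟨A, _, hA⟩ := exists_kernel_weighted_bounds hk hh H
  exact integrable_mul_of_weighted hm hB (continuous_layerKernel hk (by linarith))
    fun t => (hA x hx t).1

theorem integrable_radiationKernel_mul {k H h : ℝ} (hk : 0 < k) (hh : 0 < h) {φ : ℝ → ℂ}
    (hm : AEStronglyMeasurable φ volume) (hφ : SuperAlgebraicDecay H φ) {x : Plane}
    (hx : H + h ≤ x 1) : Integrable fun t => radiationKernel k H x (linePt H t) * φ t := by
  obtain ⟨B, _, hB⟩ := hφ.exists_bound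
  obtain ⟨A, _, hA⟩ := exists_kernel_weighted_bounds hk hh H
  have hxH : H < x 1 := by linarith
  refine integrable_mul_of_weighted hm hB ?_ fun t => (hA x hx t).2
  simp only [radiationKernel_linePt hk hxH]
  exact ((continuous_layerGrad hk hxH).clm_apply continuous_const).sub
    (continuous_const.mul (continuous_layerKernel hk hxH))

/-- Differentiation of the potential under the integral sign; the gradient of the kernel is bounded
in a half-plane `x₂ ≥ H + h / 2` containing a neighbourhood of `x`. -/
theorem hasFDerivAt_layerPotential {k H h : ℝ} (hk : 0 < k) (hh : 0 < h) {φ : ℝ → ℂ}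
    (hm : AEStronglyMeasurable φ volume) (hφ : SuperAlgebraicDecay H φ) {x : Plane}
    (hx : H + h ≤ x 1) :
    Integrable (fun t => φ t • layerGrad k H t x) ∧
    HasFDerivAt (layerPotential k H φ) (∫ t, φ t • layerGrad k H t x) x := by
  obtain ⟨B, hB0, hB⟩ := hφ.exists_bound
  obtain ⟨A, hA0, hA⟩ := exists_kernel_bounds hk (half_pos hh) H
  have hxH : H < x 1 := by linarith
  have hU : {z : Plane | H + h / 2 < z 1} ∈ 𝓝 x :=
    (isOpen_lt continuous_const (EuclideanSpace.proj (𝕜 := ℝ) (1 : Fin 2)).continuous).mem_nhds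
      (show H + h / 2 < x 1 by linarith)
  have hmeas : AEStronglyMeasurable (fun t => φ t • layerGrad k H t x) volume :=
    hm.smul (continuous_layerGrad hk hxH).aestronglyMeasurable
  have hbd : ∀ z : Plane, H + h / 2 < z 1 → ∀ t, ‖φ t • layerGrad k H t z‖
      ≤ B * A * (1 + t ^ 2)⁻¹ := by
    intro z hz t
    have ht : 1 ≤ 1 + t ^ 2 := by linarith [sq_nonneg t]
    rw [norm_smul]
    calc ‖φ t‖ * ‖layerGrad k H t z‖ ≤ B / (1 + t ^ 2) ^ 3 * A :=
          mul_le_mul (hB t) (hA z hz.le t).2.2 (norm_nonneg _) (by positivity)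
      _ ≤ B / (1 + t ^ 2) * A := by
          gcongr
          exact le_self_pow₀ ht (by norm_num)
      _ = _ := by rw [div_eq_mul_inv]; ring
  have hbi : Integrable fun t : ℝ => B * A * (1 + t ^ 2)⁻¹ :=
    integrable_inv_one_add_sq.const_mul (B * A)
  refine ⟨Integrable.mono' hbi hmeas (ae_of_all _ (hbd x (by linarith))), ?_⟩
  refine hasFDerivAt_integral_of_dominated_of_fderiv_le
    (F := fun z t => layerKernel k z (linePt H t) * φ t)
    (F' := fun z t => φ t • layerGrad k H t z) hU ?_
    (integrable_layerKernel_mul hk hh hm hφ hx) hmeas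
    (ae_of_all _ fun t z hz => hbd z hz t) hbi (ae_of_all _ fun t z hz => ?_)
  · filter_upwards [hU] with z hz
    have hz : H + h / 2 < z 1 := hz
    exact (continuous_layerKernel hk (by linarith)).aestronglyMeasurable.mul hm
  · have hz : H + h / 2 < z 1 := hz
    exact (hasFDerivAt_layerKernel hk (by linarith) t).mul_const (φ t)

theorem radialDeriv_layerPotential_sub {k H h : ℝ} (hk : 0 < k) (hh : 0 < h) {φ : ℝ → ℂ}
    (hm : AEStronglyMeasurable φ volume) (hφ : SuperAlgebraicDecay H φ) {x : Plane}
    (hx : H + h ≤ x 1) :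
    radialDeriv H (layerPotential k H φ) x - Complex.I * k * layerPotential k H φ x
      = ∫ t, radiationKernel k H x (linePt H t) * φ t := by
  obtain ⟨hi, hd⟩ := hasFDerivAt_layerPotential hk hh hm hφ hx
  have hS := integrable_layerKernel_mul hk hh hm hφ hx
  rw [radialDeriv, hd.fderiv, ← radialDir, ContinuousLinearMap.integral_apply hi, layerPotential,
    ← integral_const_mul, ← integral_sub (hi.apply_continuousLinearMap _) (hS.const_mul _)]
  refine integral_congr_ae (ae_of_all _ fun t => ?_)
  simp only [radiationKernel_linePt hk (show H < x 1 by linarith), smul_apply,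
    smul_eq_mul]
  ring

theorem mainTheorem5 (k H h : ℝ) (hk : 0 < k) (hh : 0 < h) :
    (∃ C : ℝ, 0 < C ∧ ∀ x : Plane, H + h ≤ x 1 → ∀ t : ℝ,
        ‖layerKernel k x (linePt H t)‖ ≤ C * ‖x - linePt H t‖ ^ (-(1 / 2) : ℝ) ∧
        ‖radiationKernel k H x (linePt H t)‖ ≤ C * ‖x - linePt H t‖ ^ (-(1 / 2) : ℝ) ∧
        (|t| < Real.sqrt (radius H x) →
          ‖radiationKernel k H x (linePt H t)‖ ≤ C * ‖x - linePt H t‖ ^ (-(3 / 2) : ℝ))) ∧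
    ∀ φ : ℝ → ℂ, MeasureTheory.AEStronglyMeasurable φ MeasureTheory.volume →
      SuperAlgebraicDecay H φ →
      (∀ x : Plane, H + h ≤ x 1 →
        MeasureTheory.Integrable (fun t : ℝ => layerKernel k x (linePt H t) * φ t) ∧
        MeasureTheory.Integrable (fun t : ℝ => radiationKernel k H x (linePt H t) * φ t) ∧
        DifferentiableAt ℝ (layerPotential k H φ) x ∧
        radialDeriv H (layerPotential k H φ) x - Complex.I * k * layerPotential k H φ x =
          ∫ t : ℝ, radiationKernel k H x (linePt H t) * φ t) ∧
      ∃ C : ℝ, 0 < C ∧ ∀ x : Plane, H + h ≤ x 1 →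
        ‖layerPotential k H φ x‖ ≤ C * radius H x ^ (-(1 / 2) : ℝ) ∧
        ‖radialDeriv H (layerPotential k H φ) x - Complex.I * k * layerPotential k H φ x‖ ≤
          C * radius H x ^ (-(3 / 2) : ℝ) := by
  refine ⟨?_, fun φ hm hφ => ⟨fun x hx => ⟨integrable_layerKernel_mul hk hh hm hφ hx,
    integrable_radiationKernel_mul hk hh hm hφ hx,
    (hasFDerivAt_layerPotential hk hh hm hφ hx).2.differentiableAt,
    radialDeriv_layerPotential_sub hk hh hm hφ hx⟩, ?_⟩⟩
  · obtain ⟨A, hA, hb⟩ := exists_kernel_bounds hk hh H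
    refine ⟨A * (4 + 3 / h + 2 * k), by positivity, fun x hx t => ?_⟩
    obtain ⟨h1, h2, -⟩ := hb x hx t
    have hxH : H < x 1 := by linarith
    have hhR : h ≤ ‖x - linePt H t‖ := by linarith [height_le_norm_sub_linePt H t x]
    have hhr : h ≤ radius H x := by linarith [height_le_radius H x]
    have hR : 0 < ‖x - linePt H t‖ := hh.trans_le hhR
    have hr : 0 < radius H x := hh.trans_le hhr
    have hq : 0 < 3 / h := by positivity
    refine ⟨h1.trans ?_, h2.trans ?_, fun ht => h2.trans ?_⟩
    · gcongr
      exact le_mul_of_one_le_right hA.le (by linarith)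
    · have hc := (abs_le.1 (abs_cosAngle_le_one hxH t)).1
      have h3 : 3 / ‖x - linePt H t‖ ≤ 3 / h := by gcongr
      calc _ ≤ A * ‖x - linePt H t‖ ^ (-(1 / 2) : ℝ) * (4 + 3 / h + 2 * k) := by
            refine mul_le_mul_of_nonneg_left ?_ (by positivity)
            nlinarith
        _ = _ := by ring
    · have hc : 1 - cosAngle H t x ≤ 1 / ‖x - linePt H t‖ := by
        refine (one_sub_cosAngle_le hxH t).trans ?_
        have ht2 : t ^ 2 ≤ radius H x := by
          rw [← sq_abs, ← Real.sq_sqrt hr.le]; gcongr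
        rw [div_le_div_iff₀ (by positivity) hR]
        nlinarith [mul_le_mul_of_nonneg_right ht2 hR.le, mul_pos hr hR]
      have e : ‖x - linePt H t‖ ^ (-(3 / 2) : ℝ)
          = ‖x - linePt H t‖ ^ (-(1 / 2) : ℝ) / ‖x - linePt H t‖ := by
        rw [← Real.rpow_sub_one hR.ne']; norm_num
      calc _ ≤ A * ‖x - linePt H t‖ ^ (-(1 / 2) : ℝ)
            * (3 / ‖x - linePt H t‖ + k * (1 / ‖x - linePt H t‖)) := by gcongr
        _ = A * (3 + k) * ‖x - linePt H t‖ ^ (-(3 / 2) : ℝ) := by rw [e]; ring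
        _ ≤ _ := by gcongr <;> linarith
  · obtain ⟨B, hB0, hB⟩ := hφ.exists_bound
    obtain ⟨A, hA0, hA⟩ := exists_kernel_weighted_bounds hk hh H
    refine ⟨A * B * Real.pi + 1, by positivity, fun x hx => ?_⟩
    have hr : 0 < radius H x := by linarith [height_le_radius H x]
    rw [radialDeriv_layerPotential_sub hk hh hm hφ hx]
    constructor
    · refine (norm_integral_mul_le_of_weighted hB fun t => (hA x hx t).1).trans ?_
      have := Real.rpow_pos_of_pos hr (-(1 / 2))
      linarith
    · refine (norm_integral_mul_le_of_weighted hB fun t => (hA x hx t).2).trans ?_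
      have := Real.rpow_pos_of_pos hr (-(3 / 2))
      linarith
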